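/- Let $\rho\in(-1,0)\cup(0,1)$, let $B_t=(B^1_t,B^2_t)$ $(t\in\mathbb{R})$ be a bivariate two-sided Brownian motion with $B_0=0$, $E[(B^1_1)^2]=E[(B^2_1)^2]=1$ and $E[B^1_1B^2_1]=\rho$, and let $\epsilon_i=(\epsilon^1_i,\epsilon^2_i)$ $(i=1,2,\dots)$ be i.i.d. bivariate standard normal variables independent of $B$. Let $(v_n)_{n\ge1}$ be a sequence of non-negative numbers such that $\limsup_n v_n<\infty$ and such that $\gamma:=\lim_{n\to\infty}nv_n$ exists in $[0,\infty]$. For $n\in\mathbb{N}$ and $\vartheta\in\mathbb{R}$ let $\mathbb{P}_{n,\vartheta}$ be the law on $\mathbb{R}^{2n}$ of the vector $(X_1,\dots,X_n,Y_1,\dots,Y_n)$, where, for $i=1,\dots,n$, $$X_i=B^1_{i/n}+\sqrt{v_n}\,\epsilon^1_i,\qquad Y_i=B^2_{i/n-\vartheta}+\sqrt{v_n}\,\epsilon^2_i\qquad\text{if }\vartheta\ge0,$$ $$X_i=B^1_{i/n+\vartheta}+\sqrt{v_n}\,\epsilon^1_i,\qquad Y_i=B^2_{i/n}+\sqrt{v_n}\,\epsilon^2_i\qquad\text{if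 }\vartheta<0.$$ Set $N_n=\sqrt{n/v_n}$ if $\gamma=\infty$ and $N_n=n$ otherwise, and $r_n=N_n^{-3/2}$ (if $\gamma=\infty$, then $v_n>0$, and so $N_n$ is defined, for all sufficiently large $n$). If $(\vartheta_n)$ is a sequence of real numbers with $\vartheta_n=O(r_n)$ as $n\to\infty$, then $(\mathbb{P}_{n,\vartheta_n})$ and $(\mathbb{P}_{n,0})$ are mutually contiguous; that is, for every sequence of Borel sets $A_n\subseteq\mathbb{R}^{2n}$ one has $\mathbb{P}_{n,\vartheta_n}(A_n)\to0$ if and only if $\mathbb{P}_{n,0}(A_n)\to0$. -/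

import Mathlib

open MeasureTheory ProbabilityTheory Filter Topology Asymptotics
open scoped NNReal ENNReal

noncomputable section

/-- A bivariate two-sided Brownian motion `B_t = (B¹_t, B²_t)`, `t ∈ ℝ`, with `B_0 = 0`, unit
variances and correlation `ρ`: the increments over successive intervals are independent, the
increment over `[s, t]` is centered Gaussian with covariance matrix `(t - s) [[1, ρ], [ρ, 1]]`,
and the paths are almost surely continuous. -/
structure IsTwoSidedBivariateBrownianMotion {Ω : Type*} [MeasurableSpace Ω] (ρ : ℝ)
    (B : ℝ → Ω → EuclideanSpace ℝ (Fin 2)) (μ : Measure Ω) : Prop where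
  measurable : ∀ t, Measurable (B t)
  zero : ∀ᵐ ω ∂μ, B 0 ω = 0
  indep_increments : HasIndepIncrements B μ
  law_increment : ∀ s t : ℝ, s ≤ t →
    HasLaw (fun ω => B t ω - B s ω)
      (multivariateGaussian 0 ((t - s) • !![1, ρ; ρ, 1])) μ
  continuous_paths : ∀ᵐ ω ∂μ, Continuous fun t => B t ω

/-- `ε_1, ε_2, …` (here numbered from `0`) are i.i.d. bivariate standard normal variables. -/
structure IsIIDStandardNormal {Ω : Type*} [MeasurableSpace Ω]
    (ε : ℕ → Ω → EuclideanSpace ℝ (Fin 2)) (μ : Measure Ω) : Prop where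
  measurable : ∀ i, Measurable (ε i)
  indep : iIndepFun ε μ
  law : ∀ i, HasLaw (ε i) (stdGaussian (EuclideanSpace ℝ (Fin 2))) μ

/-- The observation vector `Z_n = (X_1, …, X_n, Y_1, …, Y_n)` with lag parameter `θ` and noise
variance `w`: the lag `|θ|` acts on the second component if `θ ≥ 0` and on the first one if
`θ < 0` (so that `i / n + θ = i / n - |θ|`). The index `i : Fin n` stands for the
observation number `i + 1`. -/
def lagObservation {Ω : Type*} (B : ℝ → Ω → EuclideanSpace ℝ (Fin 2))
    (ε : ℕ → Ω → EuclideanSpace ℝ (Fin 2)) (w : ℝ≥0) (n : ℕ) (θ : ℝ) (ω : Ω) :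
    Fin n ⊕ Fin n → ℝ :=
  Sum.elim
    (fun i : Fin n =>
      B (if 0 ≤ θ then ((i : ℝ) + 1) / n else ((i : ℝ) + 1) / n + θ) ω 0
        + Real.sqrt w * ε i ω 0)
    (fun i : Fin n =>
      B (if 0 ≤ θ then ((i : ℝ) + 1) / n - θ else ((i : ℝ) + 1) / n) ω 1
        + Real.sqrt w * ε i ω 1)

/-- The law `P_{n,θ}` of the observation vector, on `ℝ^{2n}`. -/
def lagLaw {Ω : Type*} [MeasurableSpace Ω] (μ : Measure Ω)
    (B : ℝ → Ω → EuclideanSpace ℝ (Fin 2)) (ε : ℕ → Ω → EuclideanSpace ℝ (Fin 2))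
    (v : ℕ → ℝ≥0) (n : ℕ) (θ : ℝ) : Measure (Fin n ⊕ Fin n → ℝ) :=
  μ.map (lagObservation B ε (v n) n θ)

open Classical in
/-- The effective sample size `N_n`, where `γ = lim n v_n`. -/
def effectiveSampleSize (γ : ℝ≥0∞) (v : ℕ → ℝ≥0) (n : ℕ) : ℝ :=
  if γ = ∞ then Real.sqrt ((n : ℝ) / v n) else n

/-- The convergence rate `r_n = N_n ^ (-3/2)`. -/
def convergenceRate (γ : ℝ≥0∞) (v : ℕ → ℝ≥0) (n : ℕ) : ℝ :=
  effectiveSampleSize γ v n ^ (-(3 / 2) : ℝ)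

/-- `Q_n` is contiguous with respect to `P_n`: `P_n(A_n) → 0` implies `Q_n(A_n) → 0` for every
sequence of measurable sets `A_n`. -/
def IsContiguous {𝓧 : ℕ → Type*} [∀ n, MeasurableSpace (𝓧 n)]
    (Q P : ∀ n, Measure (𝓧 n)) : Prop :=
  ∀ A : ∀ n, Set (𝓧 n), (∀ n, MeasurableSet (A n)) →
    Tendsto (fun n => P n (A n)) atTop (𝓝 0) → Tendsto (fun n => Q n (A n)) atTop (𝓝 0)

/-- Mutual contiguity of two sequences of measures. -/
def IsMutuallyContiguous {𝓧 : ℕ → Type*} [∀ n, MeasurableSpace (𝓧 n)]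
    (Q P : ∀ n, Measure (𝓧 n)) : Prop :=
  IsContiguous Q P ∧ IsContiguous P Q

end

/-! Both laws are centered Gaussian on `ℝ^{2n}`, so everything can be read off their variance forms:
V₀ at lag zero and V₁ at lag θ. Suppose that, relative to V₀, the difference V₁ − V₀ has operator
norm at most 1/4 and squared Hilbert–Schmidt norm at most H. A basis diagonalizing both forms turns
the laws into products of one-dimensional Gaussians, and the density of each law has second moment
at most exp(4H) under the other. Hence Q(A)² ≤ exp(4H) P(A) in both directions
(`HasGaussianForms.measure_sq_le`), and contiguity follows once H stays bounded in n.

To bound H, summation by parts rewrites a linear form of the observations in terms of Brownian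
increments, with tail sums x (leading component) and y (lagging component) as coefficients. Passing
from lag zero to lag τ = |θ| changes the signal variance only by 2ρ times the pairing of x with an
averaged shift of y, and by a boundary term from the time interval [−τ, 0]
(`signalVar_sub_signalVar_zero`). On the other side, V₀ dominates (1 − |ρ|) times the sum of the
energies |x|²/n + w|Dx|² and |y|²/n + w|Dy|². The effective sample size N is such that the energy
controls each x_j² up to the factor N and n|Dx|² up to 4N² (`EnergyControl`). This makes the
relative operator norm O(τN).

For the Hilbert–Schmidt norm, one factor |x|²/n is kept and summed over a V₀-orthonormal family.
Evaluation at j has squared norm at most N/(1 − |ρ|), so this sum costs a factor N instead of the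
dimension 2n, and H = O(τ²N³) (`sum_signalVar_sub_sq_le`). If τ = O(N^(-3/2)), then H is bounded,
and τN → 0 because N → ∞. -/

/-! ### Second-moment domination of measures, and of Gaussian laws on the line -/

/-- `Q` is `L²`-dominated by `P` with constant `K`. For `Q ≪ P` this says that the second moment
of the density of `Q` under `P` is at most `K`. -/
def SqDominated {α : Type*} [MeasurableSpace α] (K : ℝ≥0∞) (Q P : Measure α) : Prop :=
  ∀ f : α → ℝ≥0∞, Measurable f → (∫⁻ x, f x ∂Q) ^ 2 ≤ K * ∫⁻ x, f x ^ 2 ∂P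

theorem SqDominated.measure_sq_le {α : Type*} [MeasurableSpace α] {K : ℝ≥0∞} {Q P : Measure α}
    (h : SqDominated K Q P) {A : Set α} (hA : MeasurableSet A) : Q A ^ 2 ≤ K * P A := by
  have h1 := h (A.indicator 1) (measurable_one.indicator hA)
  have h2 : ∀ x, A.indicator (1 : α → ℝ≥0∞) x ^ 2 = A.indicator 1 x := fun x => by
    by_cases hx : x ∈ A <;> simp [hx]
  simpa [h2, lintegral_indicator_one hA] using h1

theorem SqDominated.mono {α : Type*} [MeasurableSpace α] {K K' : ℝ≥0∞} {Q P : Measure α}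
    (h : SqDominated K Q P) (hK : K ≤ K') : SqDominated K' Q P := fun f hf =>
  (h f hf).trans (by gcongr)

theorem SqDominated.map {α β : Type*} [MeasurableSpace α] [MeasurableSpace β] {K : ℝ≥0∞}
    {Q P : Measure α} (h : SqDominated K Q P) {g : α → β} (hg : Measurable g) :
    SqDominated K (Q.map g) (P.map g) := fun f hf => by
  rw [lintegral_map hf hg, lintegral_map (hf.pow_const 2) hg]
  exact h _ (hf.comp hg)

theorem SqDominated.prod {α β : Type*} [MeasurableSpace α] [MeasurableSpace β] {K L : ℝ≥0∞}
    {Q P : Measure α} {Q' P' : Measure β} [SFinite Q'] [SFinite P']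
    (h : SqDominated K Q P) (h' : SqDominated L Q' P') :
    SqDominated (K * L) (Q.prod Q') (P.prod P') := fun f hf => by
  rw [lintegral_prod _ hf.aemeasurable, lintegral_prod _ (hf.pow_const 2).aemeasurable]
  refine (h _ hf.lintegral_prod_right').trans ?_
  rw [mul_assoc, ← lintegral_const_mul _ (hf.pow_const 2).lintegral_prod_right']
  gcongr with x
  exact h' _ (hf.comp measurable_prodMk_left)

theorem SqDominated.pi {k : ℕ} {α : Fin k → Type*} [∀ i, MeasurableSpace (α i)]
    {K : Fin k → ℝ≥0∞} {Q P : ∀ i, Measure (α i)} [∀ i, SigmaFinite (Q i)]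
    [∀ i, SigmaFinite (P i)] (h : ∀ i, SqDominated (K i) (Q i) (P i)) :
    SqDominated (∏ i, K i) (Measure.pi Q) (Measure.pi P) := by
  induction k with
  | zero =>
    intro f hf
    rw [Measure.pi_of_empty Q, Measure.pi_of_empty P]
    simp [lintegral_dirac' _ hf, lintegral_dirac' _ (hf.pow_const 2)]
  | succ k ih =>
    have e1 := (measurePreserving_piFinSuccAbove Q 0).symm
    have e2 := (measurePreserving_piFinSuccAbove P 0).symm
    rw [← e1.map_eq, ← e2.map_eq, Fin.prod_univ_succ]
    exact SqDominated.map ((h 0).prod (ih fun i => h i.succ)) (MeasurableEquiv.measurable _)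

/-- The squared density p_s² is a constant multiple K of p_r p_t, where 1/r = 2/s − 1/t; the
condition s < 2t makes r positive. Cauchy–Schwarz applied to p_s f = √(K p_r) · √p_t f then gives
the claim, since p_r has integral one. -/
theorem sqDominated_gaussianReal {s t : ℝ≥0} (hs : 0 < s) (hst : s < 2 * t) :
    SqDominated (ENNReal.ofReal (t / √(s * (2 * t - s)))) (gaussianReal 0 s)
      (gaussianReal 0 t) := by
  intro f hf
  have hst' : (s : ℝ) < 2 * t := by exact_mod_cast hst
  have hs' : (0 : ℝ) < s := by exact_mod_cast hs
  have ht' : (0 : ℝ) < t := by linarith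
  have hd : 0 < 2 * (t : ℝ) - s := by linarith
  set r : ℝ≥0 := (s * t / (2 * t - s) : ℝ).toNNReal with hr
  have hr' : (r : ℝ) = s * t / (2 * t - s) := Real.coe_toNNReal _ (by positivity)
  have hr0 : (0 : ℝ) < r := by rw [hr']; positivity
  have hrne : r ≠ 0 := by exact_mod_cast hr0.ne'
  have hsne : s ≠ 0 := hs.ne'
  have htne : t ≠ 0 := by exact_mod_cast ht'.ne'
  set K : ℝ := t / √(s * (2 * t - s)) with hK
  have hK0 : 0 ≤ K := by positivity
  have key : ∀ x, gaussianPDFReal 0 s x ^ 2 =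
      K * (gaussianPDFReal 0 r x * gaussianPDFReal 0 t x) := by
    intro x
    have hexp : Real.exp (-(x - 0) ^ 2 / (2 * s)) ^ 2 =
        Real.exp (-(x - 0) ^ 2 / (2 * r)) * Real.exp (-(x - 0) ^ 2 / (2 * t)) := by
      rw [← Real.exp_add, ← Real.exp_nat_mul, hr']
      congr 1
      push_cast
      field_simp
      ring
    have hc : (√(2 * Real.pi * s))⁻¹ ^ 2 =
        K * ((√(2 * Real.pi * r))⁻¹ * (√(2 * Real.pi * t))⁻¹) := by
      rw [← mul_inv, ← Real.sqrt_mul (by positivity), inv_pow, Real.sq_sqrt (by positivity), hK,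
        hr', div_mul_eq_mul_div, mul_comm (t : ℝ), mul_div_assoc, inv_mul_eq_div, div_div,
        ← Real.sqrt_mul (by positivity), inv_eq_one_div, div_eq_div_iff (by positivity) (by positivity)]
      rw [show s * (2 * t - s) * (2 * Real.pi * (s * t / (2 * t - s)) * (2 * Real.pi * t)) =
        ((2 * Real.pi * s * t) ^ 2 : ℝ) by field_simp]
      rw [Real.sqrt_sq (by positivity)]
      ring
    simp only [gaussianPDFReal]
    rw [mul_pow, hexp, hc]
    ring
  have hfac : ∀ x, gaussianPDF 0 s x =
      ENNReal.ofReal √(K * gaussianPDFReal 0 r x) * ENNReal.ofReal √(gaussianPDFReal 0 t x) := by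
    intro x
    rw [← ENNReal.ofReal_mul (by positivity), ← Real.sqrt_mul
      (mul_nonneg hK0 (gaussianPDFReal_nonneg _ _ _)), gaussianPDF, mul_assoc, ← key,
      Real.sqrt_sq (gaussianPDFReal_nonneg _ _ _)]
  have m1 : Measurable fun x => ENNReal.ofReal √(K * gaussianPDFReal 0 r x) :=
    ((measurable_gaussianPDFReal 0 r).const_mul K).sqrt.ennreal_ofReal
  have m2 : Measurable fun x => ENNReal.ofReal √(gaussianPDFReal 0 t x) :=
    (measurable_gaussianPDFReal 0 t).sqrt.ennreal_ofReal
  have q1 : ∀ x, ENNReal.ofReal √(K * gaussianPDFReal 0 r x) ^ 2 =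
      ENNReal.ofReal K * gaussianPDF 0 r x := fun x => by
    rw [← ENNReal.ofReal_pow (by positivity), Real.sq_sqrt
      (mul_nonneg hK0 (gaussianPDFReal_nonneg _ _ _)), ENNReal.ofReal_mul hK0, gaussianPDF]
  have q2 : ∀ x, ENNReal.ofReal √(gaussianPDFReal 0 t x) ^ 2 = gaussianPDF 0 t x := fun x => by
    rw [← ENNReal.ofReal_pow (by positivity), Real.sq_sqrt (gaussianPDFReal_nonneg _ _ _),
      gaussianPDF]
  rw [gaussianReal_of_var_ne_zero _ hsne, gaussianReal_of_var_ne_zero _ htne,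
    lintegral_withDensity_eq_lintegral_mul _ (measurable_gaussianPDF 0 s) hf,
    lintegral_withDensity_eq_lintegral_mul _ (measurable_gaussianPDF 0 t) (hf.pow_const 2)]
  have hCS := ENNReal.lintegral_mul_le_Lp_mul_Lq (volume : Measure ℝ) Real.HolderConjugate.two_two
    m1.aemeasurable (m2.mul hf).aemeasurable
  have hsq : ∀ a b : ℝ≥0∞, (a ^ (1 / 2 : ℝ) * b ^ (1 / 2 : ℝ)) ^ 2 = a * b := fun a b => by
    rw [mul_pow, ← ENNReal.rpow_natCast, ← ENNReal.rpow_natCast, ← ENNReal.rpow_mul,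
      ← ENNReal.rpow_mul]
    norm_num
  calc (∫⁻ x, (gaussianPDF 0 s * f) x) ^ 2
      = (∫⁻ x, ((fun x => ENNReal.ofReal √(K * gaussianPDFReal 0 r x)) *
          ((fun x => ENNReal.ofReal √(gaussianPDFReal 0 t x)) * f)) x) ^ 2 := by
        congr 2; ext x; simp only [Pi.mul_apply, hfac]; ring
    _ ≤ (_ * _) ^ 2 := pow_le_pow_left₀ zero_le hCS 2
    _ = _ := by
        rw [hsq]
        simp only [ENNReal.rpow_ofNat, Pi.mul_apply, mul_pow, q1, q2]
        rw [lintegral_const_mul _ (measurable_gaussianPDF 0 r), lintegral_gaussianPDF_eq_one _ hrne,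
          mul_one]

/-- With δ = (s − t)/t the exact constant is (1 − δ²)^(-1/2). Since δ² ≤ 1/4 and a ≥ 2δ², its square
is at most 1 + a ≤ exp(2a). The exponential form makes products over coordinates turn into sums. -/
theorem sqDominated_gaussianReal_exp {s t : ℝ≥0} {a : ℝ} (hs : 0 < s)
    (ha : |(s : ℝ) - t| ≤ t / 2) (h : 2 * ((s : ℝ) - t) ^ 2 ≤ a * t ^ 2) :
    SqDominated (ENNReal.ofReal (Real.exp a)) (gaussianReal 0 s) (gaussianReal 0 t) := by
  have hs' : (0 : ℝ) < s := by exact_mod_cast hs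
  obtain ⟨h1, h2⟩ := abs_le.1 ha
  have ht' : (0 : ℝ) < t := by
    rcases eq_or_lt_of_le t.2 with h0 | h0
    · have : (t : ℝ) = 0 := h0.symm
      linarith
    · exact h0
  refine (sqDominated_gaussianReal hs ?_).mono (ENNReal.ofReal_le_ofReal ?_)
  · rw [← NNReal.coe_lt_coe]; push_cast; linarith
  have hp : 0 < (s : ℝ) * (2 * t - s) := mul_pos hs' (by linarith)
  have ha0 : 0 ≤ a := by
    by_contra hneg
    nlinarith [sq_nonneg ((s : ℝ) - t), pow_pos ht' 2]
  rw [div_le_iff₀ (Real.sqrt_pos.2 hp)]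
  refine le_of_sq_le_sq ?_ (by positivity)
  rw [mul_pow, Real.sq_sqrt hp.le]
  have he : 1 + a ≤ Real.exp a ^ 2 := by
    have := Real.add_one_le_exp a
    nlinarith
  have hb : ((s : ℝ) - t) ^ 2 ≤ t ^ 2 / 4 := by nlinarith
  nlinarith [mul_le_mul_of_nonneg_right he hp.le]

/-! ### Comparison of Gaussian measures through their variance forms -/

section
open Matrix
open scoped MatrixOrder

/-- Write C = BᵀB and let U be an orthogonal eigenbasis of the congruent matrix B⁻ᵀDB⁻¹; then W =
B⁻¹U works. -/
theorem Matrix.PosDef.exists_simultaneous_diagonalization {ι : Type*} [Fintype ι] [DecidableEq ι]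
    {C D : Matrix ι ι ℝ} (hC : C.PosDef) (hD : D.IsHermitian) :
    ∃ (W : Matrix ι ι ℝ) (l : ι → ℝ), IsUnit W.det ∧ Wᵀ * C * W = 1 ∧
      Wᵀ * D * W = diagonal l := by
  obtain ⟨B, hB⟩ : ∃ B : Matrix ι ι ℝ, C = Bᵀ * B := by
    obtain ⟨B, hB⟩ := CStarAlgebra.nonneg_iff_eq_star_mul_self.mp hC.posSemidef.nonneg
    exact ⟨B, by rw [hB, star_eq_conjTranspose, conjTranspose_eq_transpose_of_trivial]⟩
  have hBu : IsUnit B.det := by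
    have h := hC.det_pos
    rw [hB, det_mul, det_transpose] at h
    exact isUnit_iff_ne_zero.2 fun h0 => by simp [h0] at h
  have hM : (B⁻¹ᵀ * D * B⁻¹).IsHermitian := by
    have h := isHermitian_conjTranspose_mul_mul B⁻¹ hD
    rwa [conjTranspose_eq_transpose_of_trivial] at h
  obtain ⟨U, hU⟩ : ∃ U : Matrix ι ι ℝ, U = hM.eigenvectorUnitary := ⟨_, rfl⟩
  have hUU : Uᵀ * U = 1 := by
    have h := Unitary.coe_star_mul_self hM.eigenvectorUnitary
    rwa [← hU, star_eq_conjTranspose, conjTranspose_eq_transpose_of_trivial] at h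
  have hdiag : Uᵀ * (B⁻¹ᵀ * D * B⁻¹) * U = diagonal hM.eigenvalues := by
    have h := hM.conjStarAlgAut_star_eigenvectorUnitary
    rw [Unitary.conjStarAlgAut_star_apply, ← hU, star_eq_conjTranspose,
      conjTranspose_eq_transpose_of_trivial] at h
    exact h
  have h1 : (B⁻¹ * U)ᵀ * C * (B⁻¹ * U) = 1 := by
    have e : B * B⁻¹ = 1 := mul_nonsing_inv _ hBu
    calc (B⁻¹ * U)ᵀ * C * (B⁻¹ * U) = Uᵀ * ((B * B⁻¹)ᵀ * (B * B⁻¹)) * U := by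
          rw [hB]; simp only [transpose_mul, Matrix.mul_assoc]
      _ = 1 := by rw [e]; simpa using hUU
  refine ⟨B⁻¹ * U, hM.eigenvalues, ?_, h1, ?_⟩
  · have h := congrArg det h1
    rw [det_mul, det_one] at h
    exact IsUnit.of_mul_eq_one_right _ h
  · rw [← hdiag]; simp only [transpose_mul, Matrix.mul_assoc]

/-- All linear forms of `ν` are centered Gaussian, `z ↦ u ⬝ᵥ z` having the variance `V u`. -/
structure HasGaussianForms {ι : Type*} [Fintype ι] (ν : Measure (ι → ℝ)) (V : (ι → ℝ) → ℝ) :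
    Prop where
  nonneg : ∀ u, 0 ≤ V u
  map_eq : ∀ u, ν.map (fun z => u ⬝ᵥ z) = gaussianReal 0 (V u).toNNReal

namespace HasGaussianForms

variable {ι : Type*} [Fintype ι] {ν : Measure (ι → ℝ)} {V : (ι → ℝ) → ℝ}

theorem measurable_dotProduct (u : ι → ℝ) : Measurable fun z : ι → ℝ => u ⬝ᵥ z := by
  unfold dotProduct; fun_prop

theorem isProbabilityMeasure (h : HasGaussianForms ν V) : IsProbabilityMeasure ν := by
  have : IsProbabilityMeasure (ν.map fun z => (0 : ι → ℝ) ⬝ᵥ z) := by rw [h.map_eq]; infer_instance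
  exact Measure.isProbabilityMeasure_of_map (fun z => (0 : ι → ℝ) ⬝ᵥ z)

theorem memLp (h : HasGaussianForms ν V) (u : ι → ℝ) : MemLp (fun z => u ⬝ᵥ z) 2 ν := by
  have h1 := memLp_id_gaussianReal' (μ := 0) (v := (V u).toNNReal) 2 (by simp)
  rw [← h.map_eq u] at h1
  exact (memLp_map_measure_iff aestronglyMeasurable_id
    (measurable_dotProduct u).aemeasurable).1 h1

theorem integral_sq (h : HasGaussianForms ν V) (u : ι → ℝ) : ∫ z, (u ⬝ᵥ z) ^ 2 ∂ν = V u := by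
  have h1 : ∫ x, x ^ 2 ∂gaussianReal 0 (V u).toNNReal = V u := by
    have h2 := variance_fun_id_gaussianReal (μ := 0) (v := (V u).toNNReal)
    rw [variance_eq_integral measurable_id'.aemeasurable] at h2
    simpa [h.nonneg u] using h2
  rw [← h1, ← h.map_eq u, integral_map (measurable_dotProduct u).aemeasurable
    (by fun_prop)]

/-- `V` is not assumed quadratic: it is so because it equals the second moment of a linear form, and
the matrix is the covariance matrix. -/
theorem exists_matrix (h : HasGaussianForms ν V) :
    ∃ C : Matrix ι ι ℝ, C.IsHermitian ∧ ∀ u, V u = u ⬝ᵥ C *ᵥ u := by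
  classical
  have hi : ∀ i, MemLp (fun z : ι → ℝ => z i) 2 ν := fun i => by
    simpa using h.memLp (Pi.single i 1)
  refine ⟨Matrix.of fun i j => ∫ z, z i * z j ∂ν, ?_, fun u => ?_⟩
  · ext i j
    simp [mul_comm]
  · rw [← h.integral_sq u]
    have hint : ∀ i j, Integrable (fun z : ι → ℝ => u i * u j * (z i * z j)) ν := fun i j =>
      ((hi i).integrable_mul (hi j)).const_mul _
    have e : ∀ z : ι → ℝ, (u ⬝ᵥ z) ^ 2 = ∑ i, ∑ j, u i * u j * (z i * z j) := fun z => by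
      rw [sq, dotProduct, Finset.sum_mul_sum]
      exact Finset.sum_congr rfl fun i _ => Finset.sum_congr rfl fun j _ => by ring
    simp_rw [e]
    rw [integral_finsetSum _ fun i _ => integrable_finsetSum _ fun j _ => hint i j]
    simp only [dotProduct, mulVec, Matrix.of_apply, Finset.mul_sum]
    refine Finset.sum_congr rfl fun i _ => ?_
    rw [integral_finsetSum _ fun j _ => hint i j]
    refine Finset.sum_congr rfl fun j _ => ?_
    rw [integral_const_mul]
    ring

/-- Cramér–Wold: the characteristic function of the image at t is that of the single linear form
with coefficients Wt, at 1. A diagonal variance form makes it factorize. -/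
theorem map_mulVec_transpose {k : ℕ} (h : HasGaussianForms ν V) (W : Matrix ι (Fin k) ℝ)
    (l : Fin k → ℝ≥0) (hW : ∀ c, V (W *ᵥ c) = ∑ i, l i * c i ^ 2) :
    ν.map (fun z => Wᵀ *ᵥ z) = Measure.pi fun i => gaussianReal 0 (l i) := by
  have := h.isProbabilityMeasure
  have hm : Measurable fun z : ι → ℝ => Wᵀ *ᵥ z := by
    unfold mulVec dotProduct; fun_prop
  have := Measure.isProbabilityMeasure_map (μ := ν) hm.aemeasurable
  refine (charFun_eq_pi_iff (E := fun _ => ℝ)).1 fun t => ?_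
  have h1 : charFun ((ν.map (fun z => Wᵀ *ᵥ z)).map (WithLp.toLp 2)) t =
      charFun (ν.map fun z => (W *ᵥ t.ofLp) ⬝ᵥ z) 1 := by
    rw [Measure.map_map (by fun_prop) hm, charFun_apply, charFun_apply,
      integral_map (by fun_prop) (by fun_prop),
      integral_map (measurable_dotProduct _).aemeasurable (by fun_prop)]
    refine integral_congr_ae (ae_of_all _ fun z => ?_)
    have e : inner ℝ (WithLp.toLp 2 (Wᵀ *ᵥ z)) t = (W *ᵥ t.ofLp) ⬝ᵥ z := by
      rw [PiLp.inner_apply]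
      simp only [RCLike.inner_apply, conj_trivial]
      change t.ofLp ⬝ᵥ (Wᵀ *ᵥ z) = _
      rw [dotProduct_mulVec, vecMul_transpose]
    simp [e]
  rw [h1, h.map_eq, hW]
  simp only [charFun_gaussianReal]
  rw [← Complex.exp_sum]
  congr 1
  have hnn : 0 ≤ ∑ i, (l i : ℝ) * t.ofLp i ^ 2 := by positivity
  simp [Real.coe_toNNReal _ hnn, Finset.sum_div]

theorem exists_diagonalization [DecidableEq ι] {ν₀ ν₁ : Measure (ι → ℝ)} {V₀ V₁ : (ι → ℝ) → ℝ}
    (h₀ : HasGaussianForms ν₀ V₀) (h₁ : HasGaussianForms ν₁ V₁) (hpos : ∀ u, u ≠ 0 → 0 < V₀ u) :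
    ∃ (k : ℕ) (W P : Matrix ι (Fin k) ℝ) (l : Fin k → ℝ), P * Wᵀ = 1 ∧
      (∀ c, V₀ (W *ᵥ c) = ∑ i, c i ^ 2) ∧ ∀ c, V₁ (W *ᵥ c) = ∑ i, l i * c i ^ 2 := by
  obtain ⟨C, hC, hVC⟩ := h₀.exists_matrix
  obtain ⟨D, hD, hVD⟩ := h₁.exists_matrix
  have hCpos : C.PosDef := PosDef.of_dotProduct_mulVec_pos hC fun u hu => by
    simpa [← hVC] using hpos u hu
  obtain ⟨W, l, hWu, hWC, hWD⟩ := hCpos.exists_simultaneous_diagonalization hD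
  let e := (Fintype.equivFin ι).symm
  have hform : ∀ (M : Matrix ι ι ℝ) (d : ι → ℝ), Wᵀ * M * W = diagonal d →
      ∀ c : Fin (Fintype.card ι) → ℝ,
        (W.submatrix id e *ᵥ c) ⬝ᵥ (M *ᵥ (W.submatrix id e *ᵥ c)) = ∑ i, d (e i) * c i ^ 2 := by
    intro M d hM c
    have hc : W.submatrix id e *ᵥ c = W *ᵥ (c ∘ e.symm) := by
      rw [submatrix_mulVec_equiv]; rfl
    rw [hc, dotProduct_comm, dotProduct_mulVec, ← mulVec_transpose, mulVec_mulVec, mulVec_mulVec,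
      hM, ← e.symm.sum_comp]
    simp only [dotProduct, mulVec_diagonal, Function.comp_apply, Equiv.apply_symm_apply]
    exact Finset.sum_congr rfl fun i _ => by ring
  refine ⟨Fintype.card ι, W.submatrix id e, (Wᵀ)⁻¹.submatrix id e, fun i => l (e i), ?_, ?_, ?_⟩
  · rw [transpose_submatrix, submatrix_mul_equiv, nonsing_inv_mul _ (by rwa [det_transpose])]
    simp
  · intro c
    rw [hVC, hform C 1 (by rw [hWC]; simp)]
    simp
  · intro c
    rw [hVD, hform D l hWD]

/-- In the diagonalizing coordinates `ν₀` is standard normal and `ν₁` is a product with variances `l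
i`, so the constants multiply to exp(4 ∑ (l i − 1)²). In this basis the squared Hilbert–Schmidt norm
is a sum of diagonal squares; since the basis is not explicit, `hHS` is required for every
V₀-orthonormal family. -/
theorem measure_sq_le [DecidableEq ι] {ν₀ ν₁ : Measure (ι → ℝ)} {V₀ V₁ : (ι → ℝ) → ℝ} {H : ℝ}
    (h₀ : HasGaussianForms ν₀ V₀) (h₁ : HasGaussianForms ν₁ V₁) (hpos : ∀ u, u ≠ 0 → 0 < V₀ u)
    (hop : ∀ u, |V₁ u - V₀ u| ≤ V₀ u / 4)
    (hHS : ∀ (k : ℕ) (w : Fin k → ι → ℝ), (∀ c : Fin k → ℝ, V₀ (∑ i, c i • w i) = ∑ i, c i ^ 2) →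
      ∑ i, (V₁ (w i) - V₀ (w i)) ^ 2 ≤ H) {A : Set (ι → ℝ)} (hA : MeasurableSet A) :
    ν₁ A ^ 2 ≤ ENNReal.ofReal (Real.exp (4 * H)) * ν₀ A ∧
      ν₀ A ^ 2 ≤ ENNReal.ofReal (Real.exp (4 * H)) * ν₁ A := by
  obtain ⟨k, W, P, l, hPW, hW₀, hW₁⟩ := exists_diagonalization h₀ h₁ hpos
  have hsum : ∀ c : Fin k → ℝ, ∑ i, c i • Wᵀ i = W *ᵥ c := fun c => by
    ext j; simp [mulVec, dotProduct, mul_comm]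
  have hcol : ∀ i, Wᵀ i = W *ᵥ Pi.single i 1 := fun i => by simp; rfl
  have v₀ : ∀ i, V₀ (Wᵀ i) = 1 := fun i => by rw [hcol, hW₀]; simp [Pi.single_apply, ite_pow]
  have v₁ : ∀ i, V₁ (Wᵀ i) = l i := fun i => by rw [hcol, hW₁]; simp [Pi.single_apply, ite_pow]
  have hl : ∀ i, |l i - 1| ≤ 1 / 4 := fun i => by simpa [v₀, v₁] using hop (Wᵀ i)
  have hl0 : ∀ i, 3 / 4 ≤ l i := fun i => by linarith [(abs_le.1 (hl i)).1]
  have hlsum : ∑ i, (l i - 1) ^ 2 ≤ H := by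
    simpa [v₀, v₁] using hHS k (fun i => Wᵀ i) fun c => by rw [hsum, hW₀]
  let L : Fin k → ℝ≥0 := fun i => ⟨l i, by linarith [hl0 i]⟩
  have hL : ∀ i, (L i : ℝ) = l i := fun i => rfl
  have m₀ := h₀.map_mulVec_transpose W 1 (by simpa using hW₀)
  have m₁ := h₁.map_mulVec_transpose W L hW₁
  have hmW : Measurable fun z : ι → ℝ => Wᵀ *ᵥ z := by unfold mulVec dotProduct; fun_prop
  have hmP : Measurable fun y : Fin k → ℝ => P *ᵥ y := by unfold mulVec dotProduct; fun_prop
  have hid : (fun y : Fin k → ℝ => P *ᵥ y) ∘ (fun z : ι → ℝ => Wᵀ *ᵥ z) = id := by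
    ext1 z; simp [hPW]
  have back : ∀ ν : Measure (ι → ℝ), (ν.map fun z => Wᵀ *ᵥ z).map (fun y => P *ᵥ y) = ν :=
    fun ν => by rw [Measure.map_map hmP hmW, hid, Measure.map_id]
  have hprod : ∏ i, ENNReal.ofReal (Real.exp (4 * (l i - 1) ^ 2)) ≤
      ENNReal.ofReal (Real.exp (4 * H)) := by
    rw [← ENNReal.ofReal_prod_of_nonneg fun i _ => (Real.exp_pos _).le, ← Real.exp_sum,
      ← Finset.mul_sum]
    gcongr
  constructor
  · have d := ((SqDominated.pi fun i => sqDominated_gaussianReal_exp (s := L i) (t := 1)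
      (a := 4 * (l i - 1) ^ 2) (by rw [← NNReal.coe_pos, hL]; linarith [hl0 i])
      (by rw [hL]; push_cast; linarith [hl i])
      (by rw [hL]; push_cast; nlinarith [sq_nonneg (l i - 1)])).mono hprod).map hmP
    have m₀' : (Measure.pi fun _ : Fin k => gaussianReal 0 1) = ν₀.map fun z => Wᵀ *ᵥ z := m₀.symm
    rw [← m₁, m₀', back, back] at d
    exact d.measure_sq_le hA
  -- Here the deviation is relative to `l i` instead of 1. Since `l i ≥ 3/4`, it satisfies 2 (l −
  -- 1)²/l² ≤ (32/9)(l − 1)², which is why the exponent carries 4 and not 2.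
  · have d := ((SqDominated.pi fun i => sqDominated_gaussianReal_exp (s := 1) (t := L i)
      (a := 4 * (l i - 1) ^ 2) one_pos
      (by rw [hL, NNReal.coe_one, abs_sub_comm]; linarith [hl i, hl0 i])
      (by
        rw [hL, NNReal.coe_one]
        have h9 : 9 / 16 ≤ l i ^ 2 := by nlinarith [hl0 i]
        nlinarith [mul_le_mul_of_nonneg_left h9 (sq_nonneg (l i - 1))])).mono hprod).map hmP
    have m₀' : (Measure.pi fun _ : Fin k => gaussianReal 0 1) = ν₀.map fun z => Wᵀ *ᵥ z := m₀.symm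
    rw [← m₁, m₀', back, back] at d
    exact d.measure_sq_le hA

end HasGaussianForms
end

/-! ### Laws of linear combinations of Brownian increments and of noise -/

section GaussianSums

variable {Ω : Type*} [MeasurableSpace Ω] {μ : Measure Ω}

theorem hasLaw_finsetSum_gaussianReal {ι : Type*} {X : ι → Ω → ℝ} {v : ι → ℝ}
    (hX : iIndepFun X μ) (hv : ∀ i, 0 ≤ v i)
    (h : ∀ i, HasLaw (X i) (gaussianReal 0 (v i).toNNReal) μ) (s : Finset ι) :
    HasLaw (fun ω => ∑ i ∈ s, X i ω) (gaussianReal 0 (∑ i ∈ s, v i).toNNReal) μ := by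
  have := hX.isProbabilityMeasure
  have hm : AEMeasurable (fun ω => ∑ i ∈ s, X i ω) μ :=
    Finset.aemeasurable_fun_sum s fun i _ => (h i).aemeasurable
  have := Measure.isProbabilityMeasure_map hm
  refine ⟨hm, Measure.ext_of_charFun ?_⟩
  rw [(hX.restrict s).charFun_map_fun_finsetSum_eq_prod fun i _ => (h i).aemeasurable]
  ext t
  simp_rw [Finset.prod_apply, (h _).map_eq, charFun_gaussianReal]
  rw [← Complex.exp_sum]
  congr 1
  simp [Real.coe_toNNReal _ (hv _), Real.coe_toNNReal _ (Finset.sum_nonneg fun i _ => hv i),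
    Finset.sum_mul, Finset.sum_div]

theorem hasLaw_add_gaussianReal {X Y : Ω → ℝ} {v w : ℝ} (hXY : IndepFun X Y μ) (hv : 0 ≤ v)
    (hw : 0 ≤ w) (hX : HasLaw X (gaussianReal 0 v.toNNReal) μ)
    (hY : HasLaw Y (gaussianReal 0 w.toNNReal) μ) :
    HasLaw (fun ω => X ω + Y ω) (gaussianReal 0 (v + w).toNNReal) μ := by
  have h := hXY.hasLaw_fun_add hX hY
  rwa [gaussianReal_conv_gaussianReal, add_zero, ← Real.toNNReal_add hv hw] at h

theorem hasLaw_dotProduct_multivariateGaussian {ι : Type*} [Fintype ι] [DecidableEq ι]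
    {S : Matrix ι ι ℝ} (hS : S.PosSemidef) {X : Ω → EuclideanSpace ℝ ι}
    (hX : HasLaw X (multivariateGaussian 0 S) μ) (z : ι → ℝ) :
    HasLaw (fun ω => ∑ i, z i * X ω i) (gaussianReal 0 (z ⬝ᵥ S.mulVec z).toNNReal) μ := by
  have hm : Measurable fun x : EuclideanSpace ℝ ι => ∑ i, z i * x i := by fun_prop
  have h1 : HasLaw (fun x : EuclideanSpace ℝ ι => ∑ i, z i * x i)
      (gaussianReal 0 (z ⬝ᵥ S.mulVec z).toNNReal) (multivariateGaussian 0 S) := by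
    refine ⟨hm.aemeasurable, ?_⟩
    have := Measure.isProbabilityMeasure_map (μ := multivariateGaussian 0 S) hm.aemeasurable
    refine Measure.ext_of_charFun ?_
    ext t
    have h2 := charFun_multivariateGaussian (μ := 0) hS (WithLp.toLp 2 (t • z))
    rw [charFun_apply] at h2
    rw [charFun_apply, integral_map hm.aemeasurable (by fun_prop)]
    have e : ∀ x : EuclideanSpace ℝ ι,
        inner ℝ (∑ i, z i * x i) t = inner ℝ x (WithLp.toLp 2 (t • z)) := fun x => by
      simp only [RCLike.inner_apply, conj_trivial, PiLp.inner_apply, Pi.smul_apply, smul_eq_mul,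
        Finset.mul_sum]
      exact Finset.sum_congr rfl fun i _ => by ring
    simp_rw [e]
    rw [h2, charFun_gaussianReal]
    congr 1
    have hnn : 0 ≤ z ⬝ᵥ S.mulVec z := by simpa using hS.dotProduct_mulVec_nonneg z
    rw [Real.coe_toNNReal _ hnn]
    simp only [inner_zero_right, Matrix.mulVec_smul, dotProduct_smul, smul_dotProduct, smul_eq_mul]
    push_cast
    ring
  exact h1.fun_comp hX

theorem posSemidef_smul_correlation {ρ l : ℝ} (hρ : |ρ| ≤ 1) (hl : 0 ≤ l) :
    (l • !![1, ρ; ρ, 1]).PosSemidef := by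
  refine Matrix.PosSemidef.smul ?_ hl
  refine Matrix.PosSemidef.of_dotProduct_mulVec_nonneg ?_ fun x => ?_
  · ext i j; fin_cases i <;> fin_cases j <;> simp
  · simp only [star_trivial, dotProduct, Matrix.mulVec, Fin.sum_univ_two, Matrix.of_apply,
      Matrix.cons_val', Matrix.cons_val_zero, Matrix.cons_val_one, Matrix.cons_val_fin_one]
    have h1 := (abs_le.1 hρ).1
    have h2 := (abs_le.1 hρ).2
    nlinarith [mul_nonneg (by linarith : 0 ≤ 1 + ρ) (sq_nonneg (x 0 + x 1)),
      mul_nonneg (by linarith : 0 ≤ 1 - ρ) (sq_nonneg (x 0 - x 1))]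

theorem correlation_form_nonneg {ρ : ℝ} (hρ : |ρ| ≤ 1) (p q : ℝ) :
    0 ≤ p ^ 2 + 2 * ρ * p * q + q ^ 2 := by
  have h1 := (abs_le.1 hρ).1
  have h2 := (abs_le.1 hρ).2
  nlinarith [mul_nonneg (by linarith : 0 ≤ 1 + ρ) (sq_nonneg (p + q)),
    mul_nonneg (by linarith : 0 ≤ 1 - ρ) (sq_nonneg (p - q))]

theorem IsTwoSidedBivariateBrownianMotion.hasLaw_sum_increments {ρ : ℝ}
    {B : ℝ → Ω → EuclideanSpace ℝ (Fin 2)} (hB : IsTwoSidedBivariateBrownianMotion ρ B μ)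
    (hρ : |ρ| ≤ 1) {t : ℕ → ℝ} (ht : Monotone t) (p q : ℕ → ℝ) (K : ℕ) :
    HasLaw (fun ω => ∑ k ∈ Finset.range K,
        (p k * (B (t (k + 1)) ω 0 - B (t k) ω 0) + q k * (B (t (k + 1)) ω 1 - B (t k) ω 1)))
      (gaussianReal 0 (∑ k ∈ Finset.range K,
        (t (k + 1) - t k) * (p k ^ 2 + 2 * ρ * p k * q k + q k ^ 2)).toNNReal) μ := by
  have hl : ∀ k, 0 ≤ t (k + 1) - t k := fun k => sub_nonneg.2 (ht k.le_succ)
  refine hasLaw_finsetSum_gaussianReal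
    (X := fun k ω => p k * (B (t (k + 1)) ω 0 - B (t k) ω 0) +
      q k * (B (t (k + 1)) ω 1 - B (t k) ω 1)) ?_
    (fun k => mul_nonneg (hl k) (correlation_form_nonneg hρ _ _)) (fun k => ?_) _
  · have h := (hB.indep_increments.nat ht).comp
      (fun k (x : EuclideanSpace ℝ (Fin 2)) => p k * x 0 + q k * x 1) (fun k => by fun_prop)
    exact h
  · have h := hasLaw_dotProduct_multivariateGaussian (posSemidef_smul_correlation hρ (hl k))
      (hB.law_increment (t k) (t (k + 1)) (ht k.le_succ)) ![p k, q k]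
    convert h using 2
    · simp [Fin.sum_univ_two]
    · congr 1
      simp [Fin.sum_univ_two, dotProduct, Matrix.mulVec]
      ring

theorem IsIIDStandardNormal.hasLaw_sum {ε : ℕ → Ω → EuclideanSpace ℝ (Fin 2)}
    (hε : IsIIDStandardNormal ε μ) {n : ℕ} (w : ℝ≥0) (p q : Fin n → ℝ) :
    HasLaw (fun ω => ∑ i, (p i * (√w * ε i ω 0) + q i * (√w * ε i ω 1)))
      (gaussianReal 0 (∑ i, w * (p i ^ 2 + q i ^ 2)).toNNReal) μ := by
  refine hasLaw_finsetSum_gaussianReal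
    (X := fun (i : Fin n) ω => p i * (√w * ε i ω 0) + q i * (√w * ε i ω 1)) ?_
    (fun k => by positivity) (fun k => ?_) _
  · have h := (hε.indep.precomp (g := fun i : Fin n => (i : ℕ)) Fin.val_injective).comp
      (fun k (x : EuclideanSpace ℝ (Fin 2)) => p k * (√w * x 0) + q k * (√w * x 1))
      (fun k => by fun_prop)
    exact h
  · have h1 := hε.law k
    rw [← multivariateGaussian_zero_one] at h1
    have h := hasLaw_dotProduct_multivariateGaussian Matrix.PosSemidef.one h1
      ![p k * √w, q k * √w]
    convert h using 2
    · simp [Fin.sum_univ_two, mul_assoc]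
    · congr 1
      simp only [Matrix.one_mulVec, dotProduct, Fin.sum_univ_two, Matrix.cons_val_zero,
        Matrix.cons_val_one, Matrix.cons_val_fin_one]
      linear_combination (-(p k ^ 2 + q k ^ 2)) * Real.mul_self_sqrt w.coe_nonneg

end GaussianSums

/-! ### Tail sums and summation by parts -/

section TailSums

/-- The tail sums `∑_{i ≥ k} u i` of a finite sequence. -/
noncomputable def tailSum {n : ℕ} (u : Fin n → ℝ) (k : ℕ) : ℝ :=
  ∑ i : Fin n, if k ≤ i then u i else 0

theorem tailSum_of_le {n : ℕ} (u : Fin n → ℝ) {k : ℕ} (hk : n ≤ k) : tailSum u k = 0 :=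
  Finset.sum_eq_zero fun i _ => if_neg (by omega)

theorem tailSum_sub_tailSum_succ {n : ℕ} (u : Fin n → ℝ) (i : Fin n) :
    tailSum u i - tailSum u (i + 1) = u i := by
  rw [tailSum, tailSum, ← Finset.sum_sub_distrib, Finset.sum_eq_single i]
  · simp
  · intro j _ hj
    have : (j : ℕ) ≠ i := fun h => hj (Fin.ext h)
    by_cases h : (i : ℕ) ≤ j
    · simp [h, show (i : ℕ) + 1 ≤ j by omega]
    · simp [h, show ¬ (i : ℕ) + 1 ≤ j by omega]
  · simp

theorem tailSum_sum_smul {n k : ℕ} (c : Fin k → ℝ) (w : Fin k → Fin n → ℝ) (j : ℕ) :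
    tailSum (∑ i, c i • w i) j = ∑ i, c i * tailSum (w i) j := by
  simp only [tailSum, Finset.mul_sum]
  rw [Finset.sum_comm]
  refine Finset.sum_congr rfl fun i _ => ?_
  split_ifs <;> simp

/-- Summation by parts. -/
theorem sum_mul_eq_tailSum {n : ℕ} (u : Fin n → ℝ) (b : ℕ → ℝ) :
    ∑ i : Fin n, u i * b (i + 1) =
      ∑ k ∈ Finset.range n, tailSum u k * (b (k + 1) - b k) + tailSum u 0 * b 0 := by
  have h1 : ∑ i : Fin n, u i * b (i + 1) =
      ∑ k ∈ Finset.range n, (tailSum u k - tailSum u (k + 1)) * b (k + 1) := by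
    rw [Finset.sum_range]
    exact Finset.sum_congr rfl fun i _ => by rw [tailSum_sub_tailSum_succ]
  have h2 := Finset.sum_range_sub' (fun k => tailSum u k * b k) n
  rw [tailSum_of_le u le_rfl, zero_mul, sub_zero] at h2
  rw [h1, ← h2, ← Finset.sum_add_distrib]
  exact Finset.sum_congr rfl fun k _ => by ring

end TailSums

/-! ### The common refinement of the two observation grids -/

section LagGrid

theorem sum_range_two_mul (f : ℕ → ℝ) (n : ℕ) :
    ∑ k ∈ Finset.range (2 * n), f k = ∑ k ∈ Finset.range n, (f (2 * k) + f (2 * k + 1)) := by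
  induction n with
  | zero => simp
  | succ n ih =>
    rw [Nat.mul_succ, Finset.sum_range_succ, Finset.sum_range_succ, ih, Finset.sum_range_succ]
    ring

/-- The points `k / n - θ` (even places) and `(k - m) / n` (odd places), where
`θ = m / n + s`. -/
noncomputable def lagGrid (n m : ℕ) (s : ℝ) (k : ℕ) : ℝ :=
  ((k / 2 : ℕ) : ℝ) / n - m / n - if Even k then s else 0

/-- The lengths of the intervals of `lagGrid`. -/
noncomputable def lagLength (n : ℕ) (s : ℝ) (k : ℕ) : ℝ :=
  if Even k then s else 1 / n - s

/-- The coefficient of the leading component on the intervals of `lagGrid`. -/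
noncomputable def leadCoeff (m : ℕ) (x : ℕ → ℝ) (k : ℕ) : ℝ :=
  if k < 2 * m + 1 then 0 else x ((k - (2 * m + 1)) / 2)

/-- The coefficient of the lagging component on the intervals of `lagGrid`. -/
noncomputable def lagCoeff (m : ℕ) (y : ℕ → ℝ) (k : ℕ) : ℝ :=
  y (k / 2) - if k < 2 * m + 1 then y 0 else 0

theorem lagGrid_two_mul (n m : ℕ) (s : ℝ) (k : ℕ) :
    lagGrid n m s (2 * k) = k / n - (m / n + s) := by
  simp [lagGrid]; ring

theorem lagGrid_two_mul_add_one (n m : ℕ) (s : ℝ) (k : ℕ) :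
    lagGrid n m s (2 * k + 1) = k / n - m / n := by
  have h : (2 * k + 1) / 2 = k := by omega
  simp [lagGrid, h]

theorem lagLength_two_mul (n : ℕ) (s : ℝ) (k : ℕ) : lagLength n s (2 * k) = s := by
  simp [lagLength]

theorem lagLength_two_mul_add_one (n : ℕ) (s : ℝ) (k : ℕ) :
    lagLength n s (2 * k + 1) = 1 / n - s := by
  simp [lagLength]

theorem lagGrid_succ_sub (n m : ℕ) (s : ℝ) (k : ℕ) :
    lagGrid n m s (k + 1) - lagGrid n m s k = lagLength n s k := by
  obtain ⟨j, rfl | rfl⟩ := k.even_or_odd'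
  · rw [lagGrid_two_mul, lagGrid_two_mul_add_one, lagLength_two_mul]; ring
  · rw [show 2 * j + 1 + 1 = 2 * (j + 1) by ring, lagGrid_two_mul, lagGrid_two_mul_add_one,
      lagLength_two_mul_add_one]
    push_cast
    ring

theorem lagLength_nonneg {n : ℕ} {s : ℝ} (hs : 0 ≤ s) (hs' : s ≤ 1 / n) (k : ℕ) :
    0 ≤ lagLength n s k := by
  unfold lagLength; split_ifs <;> linarith

theorem monotone_lagGrid {n m : ℕ} {s : ℝ} (hs : 0 ≤ s) (hs' : s ≤ 1 / n) :
    Monotone (lagGrid n m s) :=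
  monotone_nat_of_le_succ fun k => sub_nonneg.1 <| by
    rw [lagGrid_succ_sub]; exact lagLength_nonneg hs hs' k

theorem sum_leadCoeff_mul (n m : ℕ) (x f : ℕ → ℝ) :
    ∑ k ∈ Finset.range (2 * (n + m) + 1), leadCoeff m x k * f k =
      ∑ k ∈ Finset.range n, x k * (f (2 * (k + m) + 1) + f (2 * (k + m) + 2)) := by
  rw [show 2 * (n + m) + 1 = 2 * m + 1 + 2 * n by ring, Finset.sum_range_add,
    Finset.sum_eq_zero fun k hk => by
      rw [leadCoeff, if_pos (Finset.mem_range.1 hk), zero_mul], zero_add, sum_range_two_mul]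
  refine Finset.sum_congr rfl fun k _ => ?_
  have h1 : leadCoeff m x (2 * m + 1 + 2 * k) = x k := by
    rw [leadCoeff, if_neg (by omega)]; congr 1; omega
  have h2 : leadCoeff m x (2 * m + 1 + (2 * k + 1)) = x k := by
    rw [leadCoeff, if_neg (by omega)]; congr 1; omega
  rw [h1, h2, show 2 * m + 1 + 2 * k = 2 * (k + m) + 1 by ring,
    show 2 * m + 1 + (2 * k + 1) = 2 * (k + m) + 2 by ring, ← mul_add]

theorem sum_half_mul {n : ℕ} (m : ℕ) {y : ℕ → ℝ} (hy : ∀ k, n ≤ k → y k = 0) (f : ℕ → ℝ) :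
    ∑ k ∈ Finset.range (2 * (n + m) + 1), y (k / 2) * f k =
      ∑ k ∈ Finset.range n, y k * (f (2 * k) + f (2 * k + 1)) := by
  rw [show 2 * (n + m) + 1 = 2 * n + (2 * m + 1) by ring, Finset.sum_range_add, sum_range_two_mul,
    Finset.sum_eq_zero (s := Finset.range (2 * m + 1)) fun k _ => by
      rw [hy _ (by omega), zero_mul], add_zero]
  refine Finset.sum_congr rfl fun k _ => ?_
  rw [show 2 * k / 2 = k by omega, show (2 * k + 1) / 2 = k by omega, mul_add]

theorem sum_ite_lt_mul (n m : ℕ) (c f : ℕ → ℝ) :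
    ∑ k ∈ Finset.range (2 * (n + m) + 1), (if k < 2 * m + 1 then c k else 0) * f k =
      ∑ k ∈ Finset.range (2 * m + 1), c k * f k := by
  rw [show 2 * (n + m) + 1 = 2 * m + 1 + 2 * n by ring, Finset.sum_range_add,
    Finset.sum_eq_zero (s := Finset.range (2 * n)) fun k _ => by
      rw [if_neg (by omega), zero_mul], add_zero]
  exact Finset.sum_congr rfl fun k hk => by rw [if_pos (Finset.mem_range.1 hk)]

theorem sum_lagCoeff_mul {n : ℕ} (m : ℕ) {y : ℕ → ℝ} (hy : ∀ k, n ≤ k → y k = 0) (f : ℕ → ℝ) :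
    ∑ k ∈ Finset.range (2 * (n + m) + 1), lagCoeff m y k * f k =
      ∑ k ∈ Finset.range n, y k * (f (2 * k) + f (2 * k + 1)) -
        y 0 * ∑ k ∈ Finset.range (2 * m + 1), f k := by
  simp only [lagCoeff, sub_mul]
  rw [Finset.sum_sub_distrib, sum_half_mul m hy, sum_ite_lt_mul n m (fun _ => y 0), Finset.mul_sum]

/-- The quadratic form in which the signal enters the variance of a linear form of the observation
vector. -/
noncomputable def signalVar (ρ : ℝ) (n m : ℕ) (s : ℝ) (x y : ℕ → ℝ) : ℝ :=
  ∑ k ∈ Finset.range (2 * (n + m) + 1), lagLength n s k *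
    (leadCoeff m x k ^ 2 + 2 * ρ * leadCoeff m x k * lagCoeff m y k + lagCoeff m y k ^ 2)

/-- The quadratic form in which the noise enters the variance of a linear form of one component of
the observation vector. -/
noncomputable def noiseVar (w : ℝ) (n : ℕ) (x : ℕ → ℝ) : ℝ :=
  w * ∑ k ∈ Finset.range n, (x k - x (k + 1)) ^ 2

theorem noiseVar_tailSum (w : ℝ) {n : ℕ} (u : Fin n → ℝ) :
    noiseVar w n (tailSum u) = w * ∑ i, u i ^ 2 := by
  rw [noiseVar, Finset.sum_range]
  simp only [tailSum_sub_tailSum_succ]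

/-- The linear form of a discretely observed path in terms of its increments over `lagGrid`. -/
theorem sum_path_eq {n m : ℕ} {s : ℝ} (p q : Fin n → ℝ) (a b : ℝ → ℝ)
    (ha : a 0 = 0) (hb : b 0 = 0) :
    ∑ i : Fin n, p i * a (((i : ℕ) + 1) / n) +
        ∑ i : Fin n, q i * b (((i : ℕ) + 1) / n - (m / n + s)) =
      ∑ k ∈ Finset.range (2 * (n + m) + 1),
        (leadCoeff m (tailSum p) k * (a (lagGrid n m s (k + 1)) - a (lagGrid n m s k)) +
          lagCoeff m (tailSum q) k * (b (lagGrid n m s (k + 1)) - b (lagGrid n m s k))) := by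
  have h1 := sum_mul_eq_tailSum p fun k => a (k / n)
  have h2 := sum_mul_eq_tailSum q fun k => b (k / n - (m / n + s))
  push_cast at h1 h2
  rw [h1, h2, Finset.sum_add_distrib, sum_leadCoeff_mul,
    sum_lagCoeff_mul m (fun k hk => tailSum_of_le q hk),
    Finset.sum_range_sub (fun k => b (lagGrid n m s k)), zero_div, ha, mul_zero, add_zero]
  -- The grid starts at minus the lag and reaches time 0 at place `2 * m + 1`. As `b 0 = 0`, the
  -- boundary term of the summation by parts is minus `tailSum q 0` times the increment of `b` over
  -- these first cells; this is the correction built into `lagCoeff`.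
  have e0 : lagGrid n m s (2 * m + 1) = 0 := by rw [lagGrid_two_mul_add_one, sub_self]
  have e1 : lagGrid n m s 0 = 0 - (m / n + s) := by simpa using lagGrid_two_mul n m s 0
  rw [e0, e1, hb, zero_sub (b _), mul_neg, sub_neg_eq_add]
  refine congrArg₂ (· + ·) ?_ (congrArg₂ (· + ·) ?_ rfl)
  · refine Finset.sum_congr rfl fun k _ => ?_
    rw [show 2 * (k + m) + 2 + 1 = 2 * (k + m + 1) + 1 by ring,
      show 2 * (k + m) + 1 + 1 = 2 * (k + m) + 2 by ring, lagGrid_two_mul_add_one,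
      lagGrid_two_mul_add_one]
    push_cast
    rw [show ((k : ℝ) + m + 1) / n - m / n = (k + 1) / n by ring,
      show ((k : ℝ) + m) / n - m / n = k / n by ring]
    ring
  · refine Finset.sum_congr rfl fun k _ => ?_
    rw [show 2 * k + 1 + 1 = 2 * (k + 1) by ring, lagGrid_two_mul, lagGrid_two_mul]
    push_cast
    ring

end LagGrid

/-! ### The observation laws and their variance forms -/

section LagLaw

/-- The variance of the linear form with coefficients `u` of the observation vector, if the lag is
`m / n + s` and acts on the second component. -/
noncomputable def lagVar (ρ w : ℝ) (n m : ℕ) (s : ℝ) (u : Fin n ⊕ Fin n → ℝ) : ℝ :=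
  signalVar ρ n m s (tailSum (u ∘ Sum.inl)) (tailSum (u ∘ Sum.inr)) +
    (noiseVar w n (tailSum (u ∘ Sum.inl)) + noiseVar w n (tailSum (u ∘ Sum.inr)))

/-- The variance of the linear form with coefficients `u` of the observation vector, if the lag is
`m / n + s` and acts on the first component. -/
noncomputable def lagVarSwap (ρ w : ℝ) (n m : ℕ) (s : ℝ) (u : Fin n ⊕ Fin n → ℝ) : ℝ :=
  signalVar ρ n m s (tailSum (u ∘ Sum.inr)) (tailSum (u ∘ Sum.inl)) +
    (noiseVar w n (tailSum (u ∘ Sum.inl)) + noiseVar w n (tailSum (u ∘ Sum.inr)))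

variable {Ω : Type*} [MeasurableSpace Ω] {μ : Measure Ω} {ρ : ℝ}
  {B : ℝ → Ω → EuclideanSpace ℝ (Fin 2)} {ε : ℕ → Ω → EuclideanSpace ℝ (Fin 2)}

theorem measurable_lagObservation (hB : ∀ t, Measurable (B t)) (hε : ∀ i, Measurable (ε i))
    (w : ℝ≥0) (n : ℕ) (θ : ℝ) : Measurable (lagObservation B ε w n θ) := by
  have hB' : ∀ t j, Measurable fun ω => B t ω j := fun t j => by
    have := hB t; fun_prop
  have hε' : ∀ i j, Measurable fun ω => ε i ω j := fun i j => by
    have := hε i; fun_prop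
  refine measurable_pi_iff.2 fun a => ?_
  rcases a with i | i
  · exact (hB' _ 0).add ((hε' i 0).const_mul _)
  · exact (hB' _ 1).add ((hε' i 1).const_mul _)

theorem hasLaw_signal_add_noise (hB : IsTwoSidedBivariateBrownianMotion ρ B μ)
    (hε : IsIIDStandardNormal ε μ) (hBε : IndepFun (fun ω t => B t ω) (fun ω i => ε i ω) μ)
    (hρ : |ρ| ≤ 1) {t : ℕ → ℝ} (ht : Monotone t) (p q : ℕ → ℝ) (K : ℕ) (w : ℝ≥0) {n : ℕ}
    (x y : Fin n → ℝ) :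
    HasLaw (fun ω => ∑ k ∈ Finset.range K,
        (p k * (B (t (k + 1)) ω 0 - B (t k) ω 0) + q k * (B (t (k + 1)) ω 1 - B (t k) ω 1)) +
        ∑ i, (x i * (√w * ε i ω 0) + y i * (√w * ε i ω 1)))
      (gaussianReal 0 (∑ k ∈ Finset.range K,
        (t (k + 1) - t k) * (p k ^ 2 + 2 * ρ * p k * q k + q k ^ 2) +
        (noiseVar w n (tailSum x) + noiseVar w n (tailSum y))).toNNReal) μ := by
  have hind := hBε.comp
    (φ := fun b : ℝ → EuclideanSpace ℝ (Fin 2) => ∑ k ∈ Finset.range K,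
      (p k * (b (t (k + 1)) 0 - b (t k) 0) + q k * (b (t (k + 1)) 1 - b (t k) 1)))
    (ψ := fun e : ℕ → EuclideanSpace ℝ (Fin 2) =>
      ∑ i : Fin n, (x i * (√w * e i 0) + y i * (√w * e i 1)))
    (by fun_prop) (by fun_prop)
  have hnoise : noiseVar w n (tailSum x) + noiseVar w n (tailSum y) =
      ∑ i, (w : ℝ) * (x i ^ 2 + y i ^ 2) := by
    rw [noiseVar_tailSum, noiseVar_tailSum, ← mul_add, ← Finset.sum_add_distrib, Finset.mul_sum]
  rw [hnoise]
  exact hasLaw_add_gaussianReal hind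
    (Finset.sum_nonneg fun k _ => mul_nonneg (sub_nonneg.2 (ht k.le_succ))
      (correlation_form_nonneg hρ _ _))
    (by positivity) (hB.hasLaw_sum_increments hρ ht p q K) (hε.hasLaw_sum w x y)

theorem signalVar_add_noiseVar_nonneg (hρ : |ρ| ≤ 1) {w s : ℝ} (hw : 0 ≤ w) {n : ℕ} (m : ℕ) (hs : 0 ≤ s)
    (hs' : s ≤ 1 / n) (x y x' y' : ℕ → ℝ) :
    0 ≤ signalVar ρ n m s x y + (noiseVar w n x' + noiseVar w n y') := by
  have h1 : 0 ≤ signalVar ρ n m s x y := Finset.sum_nonneg fun k _ =>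
    mul_nonneg (lagLength_nonneg hs hs' k) (correlation_form_nonneg hρ _ _)
  have h2 : ∀ z, 0 ≤ noiseVar w n z := fun z => by unfold noiseVar; positivity
  linarith [h2 x', h2 y']

theorem hasGaussianForms_lagLaw (hB : IsTwoSidedBivariateBrownianMotion ρ B μ)
    (hε : IsIIDStandardNormal ε μ) (hBε : IndepFun (fun ω t => B t ω) (fun ω i => ε i ω) μ)
    (hρ : |ρ| ≤ 1) (v : ℕ → ℝ≥0) {n m : ℕ} {s θ : ℝ} (hs : 0 ≤ s) (hs' : s ≤ 1 / n)
    (hθ : θ = m / n + s) :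
    HasGaussianForms (lagLaw μ B ε v n θ) (lagVar ρ (v n) n m s) := by
  subst hθ
  have hθ0 : 0 ≤ (m : ℝ) / n + s := by positivity
  refine ⟨fun u => signalVar_add_noiseVar_nonneg hρ (v n).coe_nonneg m hs hs' _ _ _ _, fun u => ?_⟩
  have h := hasLaw_signal_add_noise hB hε hBε hρ (monotone_lagGrid (n := n) (m := m) hs hs')
    (leadCoeff m (tailSum (u ∘ Sum.inl))) (lagCoeff m (tailSum (u ∘ Sum.inr))) (2 * (n + m) + 1)
    (v n) (u ∘ Sum.inl) (u ∘ Sum.inr)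
  simp only [lagGrid_succ_sub] at h
  rw [lagLaw, Measure.map_map (HasGaussianForms.measurable_dotProduct u)
    (measurable_lagObservation hB.measurable hε.measurable _ _ _), lagVar, signalVar, ← h.map_eq]
  refine Measure.map_congr ?_
  filter_upwards [hB.zero] with ω hω
  have e := sum_path_eq (s := s) (m := m) (u ∘ Sum.inl) (u ∘ Sum.inr) (fun t => B t ω 0)
    (fun t => B t ω 1) (by simp [hω]) (by simp [hω])
  rw [← e]
  simp only [Function.comp_apply, dotProduct, lagObservation, Fintype.sum_sum_type, Sum.elim_inl,
    Sum.elim_inr, if_pos hθ0, mul_add, Finset.sum_add_distrib]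
  ring

/-- For a negative lag the first component is the lagging one, so the two tail sums exchange their
roles. -/
theorem hasGaussianForms_lagLaw_swap (hB : IsTwoSidedBivariateBrownianMotion ρ B μ)
    (hε : IsIIDStandardNormal ε μ) (hBε : IndepFun (fun ω t => B t ω) (fun ω i => ε i ω) μ)
    (hρ : |ρ| ≤ 1) (v : ℕ → ℝ≥0) {n m : ℕ} {s θ : ℝ} (hs : 0 ≤ s) (hs' : s ≤ 1 / n)
    (hθ : -θ = m / n + s) (hθ0 : θ < 0) :
    HasGaussianForms (lagLaw μ B ε v n θ) (lagVarSwap ρ (v n) n m s) := by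
  refine ⟨fun u => signalVar_add_noiseVar_nonneg hρ (v n).coe_nonneg m hs hs' _ _ _ _, fun u => ?_⟩
  have h := hasLaw_signal_add_noise hB hε hBε hρ (monotone_lagGrid (n := n) (m := m) hs hs')
    (lagCoeff m (tailSum (u ∘ Sum.inl))) (leadCoeff m (tailSum (u ∘ Sum.inr))) (2 * (n + m) + 1)
    (v n) (u ∘ Sum.inl) (u ∘ Sum.inr)
  simp only [lagGrid_succ_sub] at h
  have hV : lagVarSwap ρ (v n) n m s u = ∑ k ∈ Finset.range (2 * (n + m) + 1), lagLength n s k *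
      (lagCoeff m (tailSum (u ∘ Sum.inl)) k ^ 2 + 2 * ρ * lagCoeff m (tailSum (u ∘ Sum.inl)) k *
        leadCoeff m (tailSum (u ∘ Sum.inr)) k + leadCoeff m (tailSum (u ∘ Sum.inr)) k ^ 2) +
      (noiseVar (v n) n (tailSum (u ∘ Sum.inl)) + noiseVar (v n) n (tailSum (u ∘ Sum.inr))) := by
    rw [lagVarSwap, signalVar]
    congr 1
    exact Finset.sum_congr rfl fun k _ => by ring
  rw [lagLaw, Measure.map_map (HasGaussianForms.measurable_dotProduct u)
    (measurable_lagObservation hB.measurable hε.measurable _ _ _), hV, ← h.map_eq]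
  refine Measure.map_congr ?_
  filter_upwards [hB.zero] with ω hω
  have e := sum_path_eq (s := s) (m := m) (u ∘ Sum.inr) (u ∘ Sum.inl) (fun t => B t ω 1)
    (fun t => B t ω 0) (by simp [hω]) (by simp [hω])
  have e' : ∀ i : Fin n, ((i : ℕ) + 1 : ℝ) / n + θ = ((i : ℕ) + 1) / n - (m / n + s) := fun i => by
    rw [← hθ]; ring
  simp only [Finset.sum_add_distrib] at e ⊢
  rw [add_comm (∑ k ∈ Finset.range (2 * (n + m) + 1), _) (∑ k ∈ _, _), ← e]
  simp only [Function.comp_apply, dotProduct, lagObservation, Fintype.sum_sum_type, Sum.elim_inl,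
    Sum.elim_inr, if_neg hθ0.not_ge, mul_add, Finset.sum_add_distrib, e']
  ring

end LagLaw

/-! ### Energy estimates and the effective sample size -/

section Energy

/-- The energy `|x|² / n + w |Dx|²` of a sequence, `D` being the difference operator. -/
noncomputable def energy (w : ℝ) (n : ℕ) (x : ℕ → ℝ) : ℝ :=
  1 / n * ∑ k ∈ Finset.range n, x k ^ 2 + noiseVar w n x

theorem sum_range_add_le {n : ℕ} {g : ℕ → ℝ} (hg : ∀ k, 0 ≤ g k) (hg' : ∀ k, n ≤ k → g k = 0)
    (j : ℕ) (r : ℕ) : ∑ k ∈ Finset.range r, g (j + k) ≤ ∑ k ∈ Finset.range n, g k := by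
  calc ∑ k ∈ Finset.range r, g (j + k)
      ≤ ∑ k ∈ Finset.range j, g k + ∑ k ∈ Finset.range r, g (j + k) :=
        le_add_of_nonneg_left (Finset.sum_nonneg fun k _ => hg k)
    _ = ∑ k ∈ Finset.range (j + r), g k := (Finset.sum_range_add g j r).symm
    _ ≤ ∑ k ∈ Finset.range (n + (j + r)), g k :=
        Finset.sum_le_sum_of_subset_of_nonneg (Finset.range_subset_range.2 (by omega))
          fun k _ _ => hg k
    _ = ∑ k ∈ Finset.range n, g k := by
        rw [Finset.sum_range_add, Finset.sum_eq_zero (s := Finset.range (j + r)) fun k _ =>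
          hg' (n + k) (by omega), add_zero]

variable {n : ℕ} {x : ℕ → ℝ}

theorem sq_le_sum_sq (hx : ∀ k, n ≤ k → x k = 0) (j : ℕ) :
    x j ^ 2 ≤ ∑ k ∈ Finset.range n, x k ^ 2 := by
  have h := sum_range_add_le (n := n) (g := fun k => x k ^ 2) (fun k => sq_nonneg _)
    (fun k hk => by simp [hx k hk]) j 1
  simpa using h

theorem sum_add_sq_le (hx : ∀ k, n ≤ k → x k = 0) (j : ℕ) :
    ∑ k ∈ Finset.range n, x (j + k) ^ 2 ≤ ∑ k ∈ Finset.range n, x k ^ 2 :=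
  sum_range_add_le (g := fun k => x k ^ 2) (fun k => sq_nonneg _) (fun k hk => by simp [hx k hk]) j n

theorem sum_sub_succ_sq_le (hx : ∀ k, n ≤ k → x k = 0) (j : ℕ) :
    ∑ k ∈ Finset.range n, (x (j + k) - x (j + k + 1)) ^ 2 ≤
      ∑ k ∈ Finset.range n, (x k - x (k + 1)) ^ 2 :=
  sum_range_add_le (g := fun k => (x k - x (k + 1)) ^ 2) (fun k => sq_nonneg _)
    (fun k hk => by simp [hx k hk, hx (k + 1) (by omega)]) j n

/-- A shift by `m` telescopes into `m` unit differences. Cauchy–Schwarz gives one factor `m`, and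
summing the `m` shifted difference norms gives the other. -/
theorem sum_sub_shift_sq_le (hx : ∀ k, n ≤ k → x k = 0) (m : ℕ) :
    ∑ k ∈ Finset.range n, (x (k + m) - x k) ^ 2 ≤
      m ^ 2 * ∑ k ∈ Finset.range n, (x k - x (k + 1)) ^ 2 := by
  have h1 : ∀ k, (x (k + m) - x k) ^ 2 ≤
      m * ∑ j ∈ Finset.range m, (x (j + k) - x (j + k + 1)) ^ 2 := fun k => by
    have h2 := Finset.sum_range_sub' (fun j => x (j + k)) m
    have h3 := sq_sum_le_card_mul_sum_sq (s := Finset.range m)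
      (f := fun j => x (j + k) - x (j + 1 + k))
    rw [h2, Finset.card_range, zero_add, add_comm m k] at h3
    calc (x (k + m) - x k) ^ 2 = (x k - x (k + m)) ^ 2 := by ring
      _ ≤ _ := h3
      _ = _ := by simp only [add_right_comm]
  refine (Finset.sum_le_sum fun k _ => h1 k).trans ?_
  rw [← Finset.mul_sum, Finset.sum_comm, sq, mul_assoc]
  gcongr
  refine (Finset.sum_le_sum fun j _ => sum_sub_succ_sq_le hx j).trans ?_
  simp

theorem sum_sub_sq_le (hx : ∀ k, n ≤ k → x k = 0) :
    ∑ k ∈ Finset.range n, (x k - x (k + 1)) ^ 2 ≤ 4 * ∑ k ∈ Finset.range n, x k ^ 2 := by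
  have h1 := sum_add_sq_le hx 1
  have h2 : ∑ k ∈ Finset.range n, (x k - x (k + 1)) ^ 2 ≤
      ∑ k ∈ Finset.range n, (2 * x k ^ 2 + 2 * x (1 + k) ^ 2) :=
    Finset.sum_le_sum fun k _ => by rw [add_comm 1 k]; nlinarith [sq_nonneg (x k + x (k + 1))]
  rw [Finset.sum_add_distrib, ← Finset.mul_sum, ← Finset.mul_sum] at h2
  linarith

/-- `N` is an effective sample size for the noise level `w`: it controls the sequences vanishing
from `n` on by their energy. -/
structure EnergyControl (w : ℝ) (n : ℕ) (N : ℝ) : Prop where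
  pos : 0 < n
  noise_nonneg : 0 ≤ w
  one_le : 1 ≤ N
  sq_le : ∀ x : ℕ → ℝ, (∀ k, n ≤ k → x k = 0) → ∀ j, x j ^ 2 ≤ N * energy w n x
  sum_sub_sq_le : ∀ x : ℕ → ℝ, (∀ k, n ≤ k → x k = 0) →
    n * ∑ k ∈ Finset.range n, (x k - x (k + 1)) ^ 2 ≤ 4 * N ^ 2 * energy w n x

theorem noiseVar_nonneg {w : ℝ} (hw : 0 ≤ w) (n : ℕ) (x : ℕ → ℝ) : 0 ≤ noiseVar w n x := by
  unfold noiseVar; positivity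

theorem energy_nonneg {w : ℝ} (hw : 0 ≤ w) (n : ℕ) (x : ℕ → ℝ) : 0 ≤ energy w n x := by
  have := noiseVar_nonneg hw n x
  unfold energy; positivity

theorem sum_sq_le_energy {w : ℝ} (hn : 0 < n) (hw : 0 ≤ w) (x : ℕ → ℝ) :
    ∑ k ∈ Finset.range n, x k ^ 2 ≤ n * energy w n x := by
  have := noiseVar_nonneg hw n x
  have hn' : (0 : ℝ) < n := by exact_mod_cast hn
  rw [energy, mul_add, ← mul_assoc, mul_one_div_cancel hn'.ne', one_mul]
  nlinarith

/-- The noise part of the energy is not needed here: |x|² ≤ n · energy, and the difference operator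
has squared norm at most 4. -/
theorem energyControl_natCast {w : ℝ} (hn : 0 < n) (hw : 0 ≤ w) : EnergyControl w n n where
  pos := hn
  noise_nonneg := hw
  one_le := by exact_mod_cast hn
  sq_le x hx j := (sq_le_sum_sq hx j).trans (sum_sq_le_energy hn hw x)
  sum_sub_sq_le x hx := by
    have h1 := _root_.sum_sub_sq_le hx
    have h2 := sum_sq_le_energy hn hw x
    calc (n : ℝ) * ∑ k ∈ Finset.range n, (x k - x (k + 1)) ^ 2
        ≤ n * (4 * (n * energy w n x)) := by gcongr; linarith
      _ = _ := by ring

/-- A discrete Sobolev inequality: x_j² telescopes into differences of squares, each split by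
Young's inequality into a part of w|Dx|² and a part of |x|²/n. The relation N²w = n balances the two
parts, so that both carry the factor N. -/
theorem energyControl_of_sq_mul_eq {w N : ℝ} (hn : 0 < n) (hw : 0 < w) (hN : 1 ≤ N)
    (h : N ^ 2 * w = n) : EnergyControl w n N where
  pos := hn
  noise_nonneg := hw.le
  one_le := hN
  sum_sub_sq_le x hx := by
    have h0 : 0 ≤ 1 / (n : ℝ) * ∑ k ∈ Finset.range n, x k ^ 2 := by positivity
    have h1 : noiseVar w n x ≤ energy w n x := by rw [energy]; linarith
    have h2 : (n : ℝ) * ∑ k ∈ Finset.range n, (x k - x (k + 1)) ^ 2 = N ^ 2 * noiseVar w n x := by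
      rw [← h, noiseVar]; ring
    have h3 := energy_nonneg hw.le n x
    rw [h2]
    nlinarith [mul_le_mul_of_nonneg_left h1 (sq_nonneg N), mul_nonneg (sq_nonneg N) h3]
  sq_le x hx j := by
    have hn' : (0 : ℝ) < n := by exact_mod_cast hn
    have hN0 : 0 < N := by linarith
    set g : ℕ → ℝ := fun k =>
      N * w * (x k - x (k + 1)) ^ 2 + N / (2 * n) * (x k ^ 2 + x (k + 1) ^ 2) with hg
    have hg0 : ∀ k, 0 ≤ g k := fun k => by simp only [hg]; positivity
    have hle : ∀ k, x k ^ 2 - x (k + 1) ^ 2 ≤ g k := fun k => by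
      -- This identity is where N²w = n enters: the weight that Young's inequality puts on x² is the
      -- one prescribed by |x|²/n.
      have e : N / (2 * n) = 1 / (2 * (N * w)) := by
        rw [← h]; field_simp
      have e2 : x k ^ 2 - x (k + 1) ^ 2 ≤ N * w * (x k - x (k + 1)) ^ 2 +
          1 / (4 * (N * w)) * (x k + x (k + 1)) ^ 2 := by
        have e3 : 0 ≤ N * w * ((x k - x (k + 1)) - 1 / (2 * (N * w)) * (x k + x (k + 1))) ^ 2 := by
          positivity
        have e4 : N * w * ((x k - x (k + 1)) - 1 / (2 * (N * w)) * (x k + x (k + 1))) ^ 2 =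
          N * w * (x k - x (k + 1)) ^ 2 + 1 / (4 * (N * w)) * (x k + x (k + 1)) ^ 2 -
            (x k ^ 2 - x (k + 1) ^ 2) := by
          field_simp
          ring
        linarith
      have e5 : 1 / (4 * (N * w)) * (x k + x (k + 1)) ^ 2 ≤
          1 / (2 * (N * w)) * (x k ^ 2 + x (k + 1) ^ 2) := by
        have : 1 / (2 * (N * w)) * (x k ^ 2 + x (k + 1) ^ 2) -
          1 / (4 * (N * w)) * (x k + x (k + 1)) ^ 2 =
            1 / (4 * (N * w)) * (x k - x (k + 1)) ^ 2 := by
          field_simp; ring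
        have h6 : 0 ≤ 1 / (4 * (N * w)) * (x k - x (k + 1)) ^ 2 := by positivity
        linarith
      simp only [hg]
      rw [e]
      linarith
    have h1 : x j ^ 2 ≤ ∑ k ∈ Finset.range n, g k := by
      have h2 := Finset.sum_range_sub' (fun k => x (j + k) ^ 2) n
      have h3 : ∑ k ∈ Finset.range n, (x (j + k) ^ 2 - x (j + (k + 1)) ^ 2) ≤
          ∑ k ∈ Finset.range n, g (j + k) := Finset.sum_le_sum fun k _ => hle (j + k)
      have h4 := sum_range_add_le (n := n) hg0
        (fun k hk => by simp [hg, hx k hk, hx (k + 1) (by omega)]) j n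
      rw [h2, hx (j + n) (by omega)] at h3
      simp only [add_zero] at h3
      linarith
    have h5 : ∑ k ∈ Finset.range n, g k ≤ N * energy w n x := by
      simp only [hg]
      rw [Finset.sum_add_distrib, ← Finset.mul_sum, ← Finset.mul_sum, Finset.sum_add_distrib,
        energy, noiseVar]
      have h6 := sum_add_sq_le hx 1
      simp only [add_comm 1] at h6
      have h7 : 0 ≤ N / (2 * n) := by positivity
      have h8 := mul_le_mul_of_nonneg_left h6 h7
      have h9 : N * (1 / n * ∑ k ∈ Finset.range n, x k ^ 2) =
        N / (2 * n) * ∑ k ∈ Finset.range n, x k ^ 2 +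
          N / (2 * n) * ∑ k ∈ Finset.range n, x k ^ 2 := by field_simp; ring
      rw [mul_add, mul_add, h9]
      linarith
    exact h1.trans h5

end Energy

/-! ### How the signal variance depends on the lag -/

section SignalBounds

/-- The average increment of `y` over the lag `m / n + s`. -/
noncomputable def lagShift (n m : ℕ) (s : ℝ) (y : ℕ → ℝ) (k : ℕ) : ℝ :=
  1 / n * (y (k + m) - y k) + s * (y (k + m + 1) - y (k + m))

/-- The contribution of the negative time axis to `signalVar`. -/
noncomputable def lagBoundary (n m : ℕ) (s : ℝ) (y : ℕ → ℝ) : ℝ :=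
  ∑ k ∈ Finset.range (2 * m + 1), (2 * y 0 * y (k / 2) - y 0 ^ 2) * lagLength n s k

theorem lagLength_add_succ (n : ℕ) (s : ℝ) (k : ℕ) :
    lagLength n s (2 * k) + lagLength n s (2 * k + 1) = 1 / n := by
  rw [lagLength_two_mul, lagLength_two_mul_add_one]; ring

theorem sum_lagLength (n m : ℕ) (s : ℝ) :
    ∑ k ∈ Finset.range (2 * m + 1), lagLength n s k = m / n + s := by
  rw [Finset.sum_range_succ, sum_range_two_mul]
  simp only [lagLength_add_succ]
  simp only [lagLength_two_mul]
  simp [div_eq_mul_inv]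

/-- Each coefficient of either component occupies two adjacent cells of total length 1/n, so the
pure squares do not see the lag, apart from the correction by `y 0` on the negative axis. In the
cross term, `x k` meets `y (k + m)` on length 1/n − s and `y (k + m + 1)` on length s. -/
theorem signalVar_eq (ρ : ℝ) {n : ℕ} (m : ℕ) (s : ℝ) (x : ℕ → ℝ) {y : ℕ → ℝ}
    (hy : ∀ k, n ≤ k → y k = 0) :
    signalVar ρ n m s x y = 1 / n * ∑ k ∈ Finset.range n, x k ^ 2 +
      1 / n * ∑ k ∈ Finset.range n, y k ^ 2 + 2 * ρ * ∑ k ∈ Finset.range n, x k * (1 / n * y k) +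
        2 * ρ * ∑ k ∈ Finset.range n, x k * lagShift n m s y k - lagBoundary n m s y := by
  have l1 : ∀ k, leadCoeff m x (2 * (k + m) + 1) = x k := fun k => by
    rw [leadCoeff, if_neg (by omega)]; congr 1; omega
  have l2 : ∀ k, leadCoeff m x (2 * (k + m) + 2) = x k := fun k => by
    rw [leadCoeff, if_neg (by omega)]; congr 1; omega
  have c1 : ∀ k, lagCoeff m y (2 * (k + m) + 1) = y (k + m) := fun k => by
    rw [lagCoeff, if_neg (by omega), sub_zero]; congr 1; omega
  have c2 : ∀ k, lagCoeff m y (2 * (k + m) + 2) = y (k + m + 1) := fun k => by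
    rw [lagCoeff, if_neg (by omega), sub_zero]; congr 1; omega
  have e1 : ∀ k, lagLength n s (2 * (k + m) + 2) = s := fun k => lagLength_two_mul n s (k + m + 1)
  have hxx := sum_leadCoeff_mul n m x fun k => leadCoeff m x k * lagLength n s k
  have hxy := sum_leadCoeff_mul n m x fun k => lagCoeff m y k * lagLength n s k
  have hyy := sum_half_mul (n := n) m (y := fun k => y k ^ 2) (fun k hk => by simp [hy k hk])
    (lagLength n s)
  have hb := sum_ite_lt_mul n m (fun k => 2 * y 0 * y (k / 2) - y 0 ^ 2) (lagLength n s)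
  simp only [l1, l2, c1, c2, e1, lagLength_two_mul_add_one] at hxx hxy
  simp only [lagLength_add_succ] at hyy
  have hsplit : signalVar ρ n m s x y =
      ∑ k ∈ Finset.range (2 * (n + m) + 1), leadCoeff m x k * (leadCoeff m x k * lagLength n s k) +
      2 * ρ * ∑ k ∈ Finset.range (2 * (n + m) + 1),
        leadCoeff m x k * (lagCoeff m y k * lagLength n s k) +
      (∑ k ∈ Finset.range (2 * (n + m) + 1), y (k / 2) ^ 2 * lagLength n s k -
        ∑ k ∈ Finset.range (2 * (n + m) + 1),
          (if k < 2 * m + 1 then 2 * y 0 * y (k / 2) - y 0 ^ 2 else 0) * lagLength n s k) := by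
    rw [signalVar, Finset.mul_sum, ← Finset.sum_sub_distrib, ← Finset.sum_add_distrib,
      ← Finset.sum_add_distrib]
    refine Finset.sum_congr rfl fun k _ => ?_
    have : lagCoeff m y k ^ 2 =
        y (k / 2) ^ 2 - if k < 2 * m + 1 then 2 * y 0 * y (k / 2) - y 0 ^ 2 else 0 := by
      rw [lagCoeff]; split_ifs <;> ring
    rw [this]
    ring
  have a1 : ∀ k, x k * (x k * (1 / n - s) + x k * s) = 1 / n * x k ^ 2 := fun k => by ring
  have a2 : ∀ k, x k * (y (k + m) * (1 / n - s) + y (k + m + 1) * s) =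
      x k * (1 / n * y k) + x k * lagShift n m s y k := fun k => by rw [lagShift]; ring
  have a3 : ∀ k, y k ^ 2 * (1 / (n : ℝ)) = 1 / n * y k ^ 2 := fun k => mul_comm _ _
  rw [hsplit, hxx, hxy, hyy, hb, ← lagBoundary]
  simp only [a1, a2, a3, Finset.sum_add_distrib, ← Finset.mul_sum]
  ring

theorem signalVar_zero (ρ : ℝ) {n : ℕ} (x : ℕ → ℝ) {y : ℕ → ℝ} (hy : ∀ k, n ≤ k → y k = 0) :
    signalVar ρ n 0 0 x y = 1 / n * ∑ k ∈ Finset.range n, x k ^ 2 +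
      1 / n * ∑ k ∈ Finset.range n, y k ^ 2 +
        2 * ρ * ∑ k ∈ Finset.range n, x k * (1 / n * y k) := by
  rw [signalVar_eq ρ 0 0 x hy]
  simp [lagShift, lagBoundary, lagLength]

theorem signalVar_sub_signalVar_zero (ρ : ℝ) {n : ℕ} (m : ℕ) (s : ℝ) (x : ℕ → ℝ) {y : ℕ → ℝ}
    (hy : ∀ k, n ≤ k → y k = 0) :
    signalVar ρ n m s x y - signalVar ρ n 0 0 x y =
      2 * ρ * ∑ k ∈ Finset.range n, x k * lagShift n m s y k - lagBoundary n m s y := by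
  rw [signalVar_eq ρ m s x hy, signalVar_zero ρ x hy]; ring

/-- Termwise, |2ρxy| ≤ |ρ|(x² + y²); the noise has coefficient 1, which exceeds what is needed. -/
theorem energy_le_signalVar_zero_add (ρ : ℝ) {w : ℝ} (hw : 0 ≤ w) {n : ℕ}
    (x : ℕ → ℝ) {y : ℕ → ℝ} (hy : ∀ k, n ≤ k → y k = 0) :
    (1 - |ρ|) * (energy w n x + energy w n y) ≤
      signalVar ρ n 0 0 x y + (noiseVar w n x + noiseVar w n y) := by
  have hx0 := noiseVar_nonneg hw n x
  have hy0 := noiseVar_nonneg hw n y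
  have h1 : (1 - |ρ|) * (1 / n * ∑ k ∈ Finset.range n, x k ^ 2 +
      1 / n * ∑ k ∈ Finset.range n, y k ^ 2) ≤ signalVar ρ n 0 0 x y := by
    rw [signalVar_zero ρ x hy]
    simp only [Finset.mul_sum]
    rw [← Finset.sum_add_distrib, ← Finset.sum_add_distrib, Finset.mul_sum]
    refine Finset.sum_le_sum fun k _ => ?_
    have h2 : 0 ≤ |ρ| * (x k ^ 2 + y k ^ 2) + 2 * ρ * (x k * y k) := by
      rcases abs_cases ρ with ⟨h, h'⟩ | ⟨h, h'⟩ <;> rw [h]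
      · nlinarith [mul_nonneg h' (sq_nonneg (x k + y k))]
      · nlinarith [mul_nonneg (neg_nonneg.2 h'.le) (sq_nonneg (x k - y k))]
    have h3 : 0 ≤ 1 / (n : ℝ) * (|ρ| * (x k ^ 2 + y k ^ 2) + 2 * ρ * (x k * y k)) := by positivity
    linarith
  have h4 := abs_nonneg ρ
  rw [energy, energy]
  nlinarith [mul_nonneg h4 (add_nonneg hx0 hy0)]

theorem sum_lagShift_sq_le {n : ℕ} (m : ℕ) {s : ℝ} (hs : 0 ≤ s) {y : ℕ → ℝ}
    (hy : ∀ k, n ≤ k → y k = 0) :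
    ∑ k ∈ Finset.range n, lagShift n m s y k ^ 2 ≤
      2 * (m / n + s) ^ 2 * ∑ k ∈ Finset.range n, (y k - y (k + 1)) ^ 2 := by
  set D := ∑ k ∈ Finset.range n, (y k - y (k + 1)) ^ 2
  have hD : 0 ≤ D := by positivity
  have h1 := sum_sub_shift_sq_le hy m
  have h2 := sum_sub_succ_sq_le hy m
  have h3 : ∑ k ∈ Finset.range n, lagShift n m s y k ^ 2 ≤
      ∑ k ∈ Finset.range n, (2 * (1 / n) ^ 2 * (y (k + m) - y k) ^ 2 +
        2 * s ^ 2 * (y (m + k) - y (m + k + 1)) ^ 2) := by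
    refine Finset.sum_le_sum fun k _ => ?_
    rw [lagShift, add_comm m k]
    nlinarith [sq_nonneg (1 / n * (y (k + m) - y k) - s * (y (k + m + 1) - y (k + m)))]
  rw [Finset.sum_add_distrib, ← Finset.mul_sum, ← Finset.mul_sum] at h3
  have h4 : 2 * (1 / (n : ℝ)) ^ 2 * ∑ k ∈ Finset.range n, (y (k + m) - y k) ^ 2 ≤
      2 * (1 / n) ^ 2 * (m ^ 2 * D) := by gcongr
  have h5 : 2 * s ^ 2 * ∑ k ∈ Finset.range n, (y (m + k) - y (m + k + 1)) ^ 2 ≤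
      2 * s ^ 2 * D := by gcongr
  have h6 : 0 ≤ (m : ℝ) / n * s * D := by positivity
  have h7 : 2 * ((m : ℝ) / n + s) ^ 2 * D =
    2 * (1 / n) ^ 2 * (m ^ 2 * D) + 2 * s ^ 2 * D + 4 * (m / n * s * D) := by ring
  linarith

theorem abs_lagBoundary_le {n : ℕ} (m : ℕ) {s : ℝ} (hs : 0 ≤ s) (hs' : s ≤ 1 / n) {y : ℕ → ℝ}
    {M : ℝ} (hM : ∀ k, |y k| ≤ M) :
    |lagBoundary n m s y| ≤ 3 * (m / n + s) * M * |y 0| := by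
  have h1 : ∀ k ∈ Finset.range (2 * m + 1),
      |(2 * y 0 * y (k / 2) - y 0 ^ 2) * lagLength n s k| ≤ 3 * M * |y 0| * lagLength n s k :=
    fun k _ => by
      rw [abs_mul, abs_of_nonneg (lagLength_nonneg hs hs' k)]
      refine mul_le_mul_of_nonneg_right ?_ (lagLength_nonneg hs hs' k)
      rw [show 2 * y 0 * y (k / 2) - y 0 ^ 2 = (2 * y (k / 2) - y 0) * y 0 by ring, abs_mul]
      gcongr
      calc |2 * y (k / 2) - y 0| ≤ |2 * y (k / 2)| + |y 0| := abs_sub _ _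
        _ ≤ 3 * M := by rw [abs_mul, abs_two]; linarith [hM (k / 2), hM 0]
  refine (Finset.abs_sum_le_sum_abs _ _).trans ((Finset.sum_le_sum h1).trans_eq ?_)
  rw [← Finset.mul_sum, sum_lagLength]
  ring

end SignalBounds

/-! ### Operator and Hilbert–Schmidt bounds for the change of variance -/

section LagBounds

/-- Bessel's inequality. Testing the bound on the Riesz vector ∑ φ(w i) w i gives T² ≤ K T for the
sum T in question. -/
theorem sum_sq_le_of_orthonormal {E : Type*} [AddCommMonoid E] [Module ℝ E] {k : ℕ} {w : Fin k → E}
    {V φ : E → ℝ} (hw : ∀ c : Fin k → ℝ, V (∑ i, c i • w i) = ∑ i, c i ^ 2)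
    (hφ : ∀ c : Fin k → ℝ, φ (∑ i, c i • w i) = ∑ i, c i * φ (w i)) {K : ℝ} (hK : 0 ≤ K)
    (h : ∀ u, φ u ^ 2 ≤ K * V u) : ∑ i, φ (w i) ^ 2 ≤ K := by
  have h1 := h (∑ i, φ (w i) • w i)
  rw [hw, hφ] at h1
  simp only [← sq] at h1
  by_contra! hlt
  nlinarith

/-- Cauchy–Schwarz for the cross term, and the sup bound for all but one factor `y 0` of the
boundary term. The factors |x|²/n and `y 0 ^ 2` are deliberately not bounded by energies, so that
they can later be summed over an orthonormal family. -/
theorem signalVar_sub_sq_le {ρ : ℝ} (hρ : |ρ| ≤ 1) {w : ℝ} {n : ℕ} {N : ℝ}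
    (hN : EnergyControl w n N) (m : ℕ) {s : ℝ} (hs : 0 ≤ s) (hs' : s ≤ 1 / n) (x : ℕ → ℝ)
    {y : ℕ → ℝ} (hy : ∀ k, n ≤ k → y k = 0) :
    (signalVar ρ n m s x y - signalVar ρ n 0 0 x y) ^ 2 ≤
      (m / n + s) ^ 2 * N * energy w n y *
        (64 * N * (1 / n * ∑ k ∈ Finset.range n, x k ^ 2) + 18 * y 0 ^ 2) := by
  have hn : (0 : ℝ) < n := by exact_mod_cast hN.pos
  have hN0 : 0 ≤ N := zero_le_one.trans hN.one_le
  have hE := energy_nonneg hN.noise_nonneg n y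
  rw [signalVar_sub_signalVar_zero ρ m s x hy]
  set τ : ℝ := m / n + s
  set S := ∑ k ∈ Finset.range n, x k ^ 2
  set D := ∑ k ∈ Finset.range n, (y k - y (k + 1)) ^ 2
  set A := ∑ k ∈ Finset.range n, x k * lagShift n m s y k
  set R := lagBoundary n m s y
  have hS : 0 ≤ S := by positivity
  have hA : A ^ 2 ≤ S * (2 * τ ^ 2 * D) :=
    (Finset.sum_mul_sq_le_sq_mul_sq _ _ _).trans
      (mul_le_mul_of_nonneg_left (sum_lagShift_sq_le m hs hy) hS)
  have hD : D ≤ 4 * N ^ 2 * energy w n y / n := by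
    rw [le_div_iff₀ hn, mul_comm]; exact hN.sum_sub_sq_le y hy
  have hR : R ^ 2 ≤ 9 * τ ^ 2 * (N * energy w n y) * y 0 ^ 2 := by
    have h1 := abs_lagBoundary_le m hs hs' (y := y) (M := √(N * energy w n y))
      fun k => Real.abs_le_sqrt (hN.sq_le y hy k)
    have h2 := pow_le_pow_left₀ (abs_nonneg _) h1 2
    rw [sq_abs, mul_pow, mul_pow, mul_pow, Real.sq_sqrt (by positivity), sq_abs] at h2
    linarith
  have hA2 : A ^ 2 ≤ 8 * τ ^ 2 * N ^ 2 * energy w n y * (1 / n * S) :=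
    calc A ^ 2 ≤ S * (2 * τ ^ 2 * D) := hA
      _ ≤ S * (2 * τ ^ 2 * (4 * N ^ 2 * energy w n y / n)) := by gcongr
      _ = _ := by ring
  have hρ2 : ρ ^ 2 ≤ 1 := by
    rw [← sq_abs]; exact pow_le_one₀ (abs_nonneg ρ) hρ
  have h3 : (ρ * A) ^ 2 ≤ A ^ 2 := by
    rw [mul_pow]; exact mul_le_of_le_one_left (sq_nonneg A) hρ2
  have h4 : (2 * ρ * A - R) ^ 2 ≤ 8 * (ρ * A) ^ 2 + 2 * R ^ 2 := by
    nlinarith [sq_nonneg (2 * (ρ * A) + R)]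
  linarith

theorem abs_signalVar_sub_le {ρ : ℝ} (hρ : |ρ| < 1) {w : ℝ} {n : ℕ} {N : ℝ}
    (hN : EnergyControl w n N) {m : ℕ} {s : ℝ} (hs : 0 ≤ s) (hs' : s ≤ 1 / n)
    (hsmall : 40 * (m / n + s) * N ≤ 1 - |ρ|) (x : ℕ → ℝ) {y : ℕ → ℝ}
    (hy : ∀ k, n ≤ k → y k = 0) :
    |signalVar ρ n m s x y - signalVar ρ n 0 0 x y| ≤
      (1 - |ρ|) * (energy w n x + energy w n y) / 4 := by
  have h := signalVar_sub_sq_le hρ.le hN m hs hs' x hy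
  have hn : (0 : ℝ) < n := by exact_mod_cast hN.pos
  have hN0 : 0 ≤ N := zero_le_one.trans hN.one_le
  have hEx := energy_nonneg hN.noise_nonneg n x
  have hEy := energy_nonneg hN.noise_nonneg n y
  set τ : ℝ := m / n + s
  have hτ : 0 ≤ τ := by positivity
  have h1 : 1 / (n : ℝ) * ∑ k ∈ Finset.range n, x k ^ 2 ≤ energy w n x := by
    rw [energy]; linarith [noiseVar_nonneg hN.noise_nonneg n x]
  have h2 := hN.sq_le y hy 0
  set ex := energy w n x
  set ey := energy w n y
  have h3 : (signalVar ρ n m s x y - signalVar ρ n 0 0 x y) ^ 2 ≤ (10 * τ * N * (ex + ey)) ^ 2 :=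
    calc _ ≤ τ ^ 2 * N * ey * (64 * N * (1 / n * ∑ k ∈ Finset.range n, x k ^ 2) + 18 * y 0 ^ 2) := h
      _ ≤ τ ^ 2 * N * ey * (64 * N * ex + 18 * (N * ey)) := by gcongr
      _ = (τ * N) ^ 2 * (64 * (ex * ey) + 18 * ey ^ 2) := by ring
      _ ≤ (τ * N) ^ 2 * (100 * (ex + ey) ^ 2) := by
        gcongr
        nlinarith [mul_nonneg hEx hEy, sq_nonneg ex, sq_nonneg ey]
      _ = _ := by ring
  have h4 := abs_le_of_sq_le_sq h3 (by positivity)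
  have h5 := mul_le_mul_of_nonneg_right hsmall (add_nonneg hEx hEy)
  linarith

/-- Bounding every term by its energies would produce the dimension as a factor. Instead only the
energy of `Y` is bounded by 1/(1 − |ρ|); the remaining factors are squares of linear functionals,
whose sums are at most N/(1 − |ρ|) by Bessel's inequality. -/
theorem sum_signalVar_sub_sq_le {ρ : ℝ} (hρ : |ρ| < 1) {ν : ℝ} {n : ℕ} {N : ℝ}
    (hN : EnergyControl ν n N) (m : ℕ) {s : ℝ} (hs : 0 ≤ s) (hs' : s ≤ 1 / n)
    {E : Type*} [AddCommMonoid E] [Module ℝ E] {V : E → ℝ} {X Y : E → ℕ → ℝ}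
    (hV : ∀ u, (1 - |ρ|) * (energy ν n (X u) + energy ν n (Y u)) ≤ V u)
    (hX : ∀ u k, n ≤ k → X u k = 0) (hY : ∀ u k, n ≤ k → Y u k = 0)
    {k : ℕ} {w : Fin k → E} (hw : ∀ c : Fin k → ℝ, V (∑ i, c i • w i) = ∑ i, c i ^ 2)
    (hXw : ∀ (c : Fin k → ℝ) j, X (∑ i, c i • w i) j = ∑ i, c i * X (w i) j)
    (hYw : ∀ (c : Fin k → ℝ) j, Y (∑ i, c i • w i) j = ∑ i, c i * Y (w i) j) :
    ∑ i, (signalVar ρ n m s (X (w i)) (Y (w i)) - signalVar ρ n 0 0 (X (w i)) (Y (w i))) ^ 2 ≤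
      82 * ((m / n + s) ^ 2 * N ^ 3) / (1 - |ρ|) ^ 2 := by
  classical
  have hn : (0 : ℝ) < n := by exact_mod_cast hN.pos
  have hN1 := hN.one_le
  have hN0 : 0 ≤ N := zero_le_one.trans hN1
  have hκ : 0 < 1 - |ρ| := by linarith
  set κ := 1 - |ρ|
  set τ : ℝ := m / n + s
  have hEx := fun u => energy_nonneg hN.noise_nonneg n (X u)
  have hEy := fun u => energy_nonneg hN.noise_nonneg n (Y u)
  have hVx : ∀ u, energy ν n (X u) ≤ 1 / κ * V u := fun u => by
    rw [one_div_mul_eq_div, le_div_iff₀ hκ]; nlinarith [hV u, hEy u]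
  have hVy : ∀ u, energy ν n (Y u) ≤ 1 / κ * V u := fun u => by
    rw [one_div_mul_eq_div, le_div_iff₀ hκ]; nlinarith [hV u, hEx u]
  have hV1 : ∀ i, V (w i) = 1 := fun i => by
    have h := hw (Pi.single i 1)
    simpa [Pi.single_apply, ite_pow] using h
  have bX : ∀ j, ∑ i, X (w i) j ^ 2 ≤ N / κ := fun j =>
    sum_sq_le_of_orthonormal (φ := fun u => X u j) hw (fun c => hXw c j) (by positivity) fun u =>
      calc X u j ^ 2 ≤ N * energy ν n (X u) := hN.sq_le _ (hX u) j
        _ ≤ N * (1 / κ * V u) := by gcongr; exact hVx u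
        _ = N / κ * V u := by ring
  have bY : ∑ i, Y (w i) 0 ^ 2 ≤ N / κ :=
    sum_sq_le_of_orthonormal (φ := fun u => Y u 0) hw (fun c => hYw c 0) (by positivity) fun u =>
      calc Y u 0 ^ 2 ≤ N * energy ν n (Y u) := hN.sq_le _ (hY u) 0
        _ ≤ N * (1 / κ * V u) := by gcongr; exact hVy u
        _ = N / κ * V u := by ring
  have bS : ∑ i, (1 / n * ∑ k ∈ Finset.range n, X (w i) k ^ 2) ≤ N / κ := by
    rw [← Finset.mul_sum, Finset.sum_comm, one_div_mul_eq_div, div_le_iff₀ hn]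
    refine (Finset.sum_le_sum fun j _ => bX j).trans_eq ?_
    simp [mul_comm]
  have hterm : ∀ i, (signalVar ρ n m s (X (w i)) (Y (w i)) -
      signalVar ρ n 0 0 (X (w i)) (Y (w i))) ^ 2 ≤ τ ^ 2 * N * (1 / κ) *
        (64 * N * (1 / n * ∑ k ∈ Finset.range n, X (w i) k ^ 2) + 18 * Y (w i) 0 ^ 2) := fun i => by
    refine (signalVar_sub_sq_le hρ.le hN m hs hs' (X (w i)) (hY (w i))).trans ?_
    gcongr
    simpa [hV1] using hVy (w i)
  calc _ ≤ ∑ i, τ ^ 2 * N * (1 / κ) *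
        (64 * N * (1 / n * ∑ k ∈ Finset.range n, X (w i) k ^ 2) + 18 * Y (w i) 0 ^ 2) :=
        Finset.sum_le_sum fun i _ => hterm i
    _ = τ ^ 2 * N * (1 / κ) * (64 * N * ∑ i, (1 / n * ∑ k ∈ Finset.range n, X (w i) k ^ 2) +
          18 * ∑ i, Y (w i) 0 ^ 2) := by
        simp only [Finset.sum_add_distrib, ← Finset.mul_sum]
    _ ≤ τ ^ 2 * N * (1 / κ) * (64 * N * (N / κ) + 18 * (N / κ)) := by gcongr
    -- The boundary contributes only τ²N²; `1 ≤ N` absorbs it, giving 64 + 18 = 82.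
    _ ≤ τ ^ 2 * N * (1 / κ) * (64 * N * (N / κ) + 18 * N * (N / κ)) := by
        gcongr
        linarith
    _ = 82 * (τ ^ 2 * N ^ 3) / κ ^ 2 := by field_simp; ring

/-- At lag zero the form is symmetric in the two components, so lags of both signs are compared with
the same V₀. -/
theorem lagVarSwap_zero (ρ w : ℝ) (n : ℕ) : lagVarSwap ρ w n 0 0 = lagVar ρ w n 0 0 := by
  funext u
  rw [lagVar, lagVarSwap, signalVar_zero _ _ fun k hk => tailSum_of_le _ hk,
    signalVar_zero _ _ fun k hk => tailSum_of_le _ hk]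
  have : ∀ x y : ℕ → ℝ, ∀ k, x k * (1 / n * y k) = y k * (1 / n * x k) := fun x y k => by ring
  simp only [this (tailSum (u ∘ Sum.inr))]
  ring

theorem le_lagVar_zero (ρ : ℝ) {w : ℝ} (hw : 0 ≤ w) {n : ℕ} (u : Fin n ⊕ Fin n → ℝ) :
    (1 - |ρ|) * (energy w n (tailSum (u ∘ Sum.inl)) + energy w n (tailSum (u ∘ Sum.inr))) ≤
      lagVar ρ w n 0 0 u :=
  energy_le_signalVar_zero_add ρ hw _ fun _ hk => tailSum_of_le _ hk

theorem lagVar_zero_pos {ρ : ℝ} (hρ : |ρ| < 1) {w : ℝ} {n : ℕ} {N : ℝ}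
    (hN : EnergyControl w n N) {u : Fin n ⊕ Fin n → ℝ} (hu : u ≠ 0) : 0 < lagVar ρ w n 0 0 u := by
  by_contra! hle
  have h1 := (le_lagVar_zero ρ hN.noise_nonneg u).trans hle
  have hκ : 0 < 1 - |ρ| := by linarith
  have hEx := energy_nonneg hN.noise_nonneg n (tailSum (u ∘ Sum.inl))
  have hEy := energy_nonneg hN.noise_nonneg n (tailSum (u ∘ Sum.inr))
  have h2 : energy w n (tailSum (u ∘ Sum.inl)) + energy w n (tailSum (u ∘ Sum.inr)) ≤ 0 := by
    by_contra! h; nlinarith [mul_pos hκ h]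
  have hz : ∀ p : Fin n → ℝ, energy w n (tailSum p) ≤ 0 → ∀ i, p i = 0 := fun p hp i => by
    have h0 : ∀ j, tailSum p j = 0 := fun j => by
      have h3 := hN.sq_le (tailSum p) (fun k hk => tailSum_of_le p hk) j
      have h4 : N * energy w n (tailSum p) ≤ 0 :=
        mul_nonpos_of_nonneg_of_nonpos (zero_le_one.trans hN.one_le) hp
      exact pow_eq_zero_iff two_ne_zero |>.1 (le_antisymm (h3.trans h4) (sq_nonneg _))
    rw [← tailSum_sub_tailSum_succ p i, h0, h0, sub_zero]
  refine hu (funext fun a => ?_)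
  rcases a with i | i
  · exact hz (u ∘ Sum.inl) (by linarith) i
  · exact hz (u ∘ Sum.inr) (by linarith) i

variable {Ω : Type*} [MeasurableSpace Ω] {μ : Measure Ω} {ρ : ℝ}
  {B : ℝ → Ω → EuclideanSpace ℝ (Fin 2)} {ε : ℕ → Ω → EuclideanSpace ℝ (Fin 2)}

theorem lagLaw_measure_sq_le (hB : IsTwoSidedBivariateBrownianMotion ρ B μ)
    (hε : IsIIDStandardNormal ε μ) (hBε : IndepFun (fun ω t => B t ω) (fun ω i => ε i ω) μ)
    (hρ : |ρ| < 1) (v : ℕ → ℝ≥0) {n : ℕ} {N θ : ℝ} (hN : EnergyControl (v n) n N)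
    (hθ : 40 * |θ| * N ≤ 1 - |ρ|) {A : Set (Fin n ⊕ Fin n → ℝ)} (hA : MeasurableSet A) :
    lagLaw μ B ε v n θ A ^ 2 ≤
        ENNReal.ofReal (Real.exp (4 * (82 * (θ ^ 2 * N ^ 3) / (1 - |ρ|) ^ 2))) *
          lagLaw μ B ε v n 0 A ∧
      lagLaw μ B ε v n 0 A ^ 2 ≤
        ENNReal.ofReal (Real.exp (4 * (82 * (θ ^ 2 * N ^ 3) / (1 - |ρ|) ^ 2))) *
          lagLaw μ B ε v n θ A := by
  have hn : (0 : ℝ) < n := by exact_mod_cast hN.pos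
  -- The lag is split into whole sampling steps and a remainder of at most one step, as the common
  -- grid requires.
  set m := ⌊(n : ℝ) * |θ|⌋₊
  set s : ℝ := |θ| - m / n with hs_def
  have hm : (m : ℝ) ≤ n * |θ| := Nat.floor_le (by positivity)
  have hm' : (n : ℝ) * |θ| < m + 1 := Nat.lt_floor_add_one _
  have hs : 0 ≤ s := by
    rw [hs_def, sub_nonneg, div_le_iff₀ hn, mul_comm]; exact hm
  have hs' : s ≤ 1 / n := by
    rw [hs_def, sub_le_iff_le_add, ← add_div, le_div_iff₀ hn, mul_comm]; linarith
  have hms : (m : ℝ) / n + s = |θ| := by rw [hs_def]; ring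
  have h₀ : HasGaussianForms (lagLaw μ B ε v n 0) (lagVar ρ (v n) n 0 0) :=
    hasGaussianForms_lagLaw hB hε hBε hρ.le v le_rfl (by positivity) (by simp)
  have hsmall : 40 * ((m : ℝ) / n + s) * N ≤ 1 - |ρ| := by rw [hms]; exact hθ
  have hpos : ∀ u, u ≠ 0 → 0 < lagVar ρ (v n) n 0 0 u := fun u hu => lagVar_zero_pos hρ hN hu
  have hl : ∀ (p : Fin n → ℝ) k, n ≤ k → tailSum p k = 0 := fun p k hk => tailSum_of_le p hk
  have hcomp : ∀ {k : ℕ} (c : Fin k → ℝ) (w : Fin k → Fin n ⊕ Fin n → ℝ) (g : Fin n → Fin n ⊕ Fin n),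
      (∑ i, c i • w i) ∘ g = ∑ i, c i • (w i ∘ g) := fun c w g => by
    ext j; simp
  have hlin : ∀ {k : ℕ} (w : Fin k → Fin n ⊕ Fin n → ℝ) (g : Fin n → Fin n ⊕ Fin n)
      (c : Fin k → ℝ) (j : ℕ), tailSum ((∑ i, c i • w i) ∘ g) j =
        ∑ i, c i * tailSum (w i ∘ g) j := fun w g c j => by
    rw [hcomp, tailSum_sum_smul]
  rw [← sq_abs θ, ← hms]
  rcases le_or_gt 0 θ with h | h
  · have h₁ := hasGaussianForms_lagLaw hB hε hBε hρ.le v hs hs'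
      (show θ = m / n + s by rw [hms, abs_of_nonneg h])
    have hdiff : ∀ u, lagVar ρ (v n) n m s u - lagVar ρ (v n) n 0 0 u =
        signalVar ρ n m s (tailSum (u ∘ Sum.inl)) (tailSum (u ∘ Sum.inr)) -
          signalVar ρ n 0 0 (tailSum (u ∘ Sum.inl)) (tailSum (u ∘ Sum.inr)) := fun u => by
      rw [lagVar, lagVar]; ring
    refine h₀.measure_sq_le h₁ hpos (fun u => ?_) (fun k w hw => ?_) hA
    · rw [hdiff]
      refine (abs_signalVar_sub_le hρ hN hs hs' hsmall _ (hl _)).trans ?_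
      linarith [le_lagVar_zero ρ hN.noise_nonneg u]
    · simp only [hdiff]
      exact sum_signalVar_sub_sq_le hρ hN m hs hs' (X := fun u => tailSum (u ∘ Sum.inl))
        (Y := fun u => tailSum (u ∘ Sum.inr)) (le_lagVar_zero ρ hN.noise_nonneg) (fun u => hl _)
        (fun u => hl _) hw (hlin w _) (hlin w _)
  · have h₁ := hasGaussianForms_lagLaw_swap hB hε hBε hρ.le v hs hs'
      (show -θ = m / n + s by rw [hms, abs_of_neg h]) h
    have hdiff : ∀ u, lagVarSwap ρ (v n) n m s u - lagVar ρ (v n) n 0 0 u =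
        signalVar ρ n m s (tailSum (u ∘ Sum.inr)) (tailSum (u ∘ Sum.inl)) -
          signalVar ρ n 0 0 (tailSum (u ∘ Sum.inr)) (tailSum (u ∘ Sum.inl)) := fun u => by
      rw [← lagVarSwap_zero, lagVarSwap, lagVarSwap]; ring
    refine h₀.measure_sq_le h₁ hpos (fun u => ?_) (fun k w hw => ?_) hA
    · rw [hdiff]
      refine (abs_signalVar_sub_le hρ hN hs hs' hsmall _ (hl _)).trans ?_
      linarith [le_lagVar_zero ρ hN.noise_nonneg u]
    · simp only [hdiff]
      exact sum_signalVar_sub_sq_le hρ hN m hs hs' (X := fun u => tailSum (u ∘ Sum.inr))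
        (Y := fun u => tailSum (u ∘ Sum.inl))
        (fun u => (by rw [add_comm (energy _ _ _)]; exact le_lagVar_zero ρ hN.noise_nonneg u))
        (fun u => hl _) (fun u => hl _) hw (hlin w _) (hlin w _)

end LagBounds

/-! ### From uniform bounds to contiguity -/

section Contiguity

theorem IsContiguous.of_measure_sq_le {𝓧 : ℕ → Type*} [∀ n, MeasurableSpace (𝓧 n)]
    {Q P : ∀ n, Measure (𝓧 n)} {K : ℝ≥0∞} (hK : K ≠ ∞)
    (h : ∀ᶠ n in atTop, ∀ A : Set (𝓧 n), MeasurableSet A → Q n A ^ 2 ≤ K * P n A) :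
    IsContiguous Q P := by
  intro A hA hP
  have h1 : Tendsto (fun n => K * P n (A n)) atTop (𝓝 0) := by
    simpa using ENNReal.Tendsto.const_mul hP (Or.inr hK)
  have h2 : Tendsto (fun n => Q n (A n) ^ 2) atTop (𝓝 0) :=
    tendsto_of_tendsto_of_tendsto_of_le_of_le' tendsto_const_nhds h1
      (Eventually.of_forall fun _ => zero_le) (h.mono fun n hn => hn _ (hA n))
  have h3 := ((ENNReal.continuous_rpow_const (y := 1 / 2)).tendsto 0).comp h2
  have h4 : ∀ a : ℝ≥0∞, (a ^ 2) ^ (2⁻¹ : ℝ) = a := fun a => by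
    rw [← ENNReal.rpow_natCast, ← ENNReal.rpow_mul]; norm_num
  simpa [Function.comp_def, h4] using h3

/-- If γ = ∞, then `v n > 0` eventually, N²v = n holds by the choice of N, and N → ∞ because `v` is
eventually bounded. Otherwise N = n. -/
theorem eventually_energyControl {v : ℕ → ℝ≥0} {γ : ℝ≥0∞}
    (hγ : Tendsto (fun n : ℕ => (n : ℝ≥0∞) * (v n : ℝ≥0∞)) atTop (𝓝 γ))
    (hv : limsup (fun n : ℕ => (v n : ℝ≥0∞)) atTop < ∞) :
    Tendsto (effectiveSampleSize γ v) atTop atTop ∧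
      ∀ᶠ n in atTop, EnergyControl (v n) n (effectiveSampleSize γ v n) := by
  by_cases hγ' : γ = ∞
  · subst hγ'
    obtain ⟨M, hM, hM'⟩ := exists_between hv
    lift M to ℝ≥0 using hM'.ne
    have hb : ∀ᶠ n in atTop, v n ≤ M := (eventually_lt_of_limsup_lt hM).mono fun n hn =>
      by exact_mod_cast hn.le
    have hp : ∀ᶠ n in atTop, 0 < v n := by
      filter_upwards [hγ.eventually (lt_mem_nhds ENNReal.zero_lt_top)] with n hn
      rw [pos_iff_ne_zero]
      rintro h0
      simp [h0] at hn
    have hsize : ∀ n, effectiveSampleSize ∞ v n = √((n : ℝ) / v n) := fun n => by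
      simp [effectiveSampleSize]
    have ht : Tendsto (effectiveSampleSize ∞ v) atTop atTop := by
      have h1 : Tendsto (fun n : ℕ => √((n : ℝ) / (M + 1))) atTop atTop :=
        Real.tendsto_sqrt_atTop.comp
          (tendsto_natCast_atTop_atTop.atTop_div_const (by positivity))
      refine tendsto_atTop_mono' _ ?_ h1
      filter_upwards [hb, hp] with n hn hn'
      rw [hsize]
      have h2 : (v n : ℝ) ≤ M := by exact_mod_cast hn
      have h3 : (0 : ℝ) < v n := by exact_mod_cast hn'
      gcongr
      linarith
    refine ⟨ht, ?_⟩
    filter_upwards [hp, ht.eventually_ge_atTop 1, eventually_gt_atTop 0] with n hn hn1 hn0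
    have h3 : (0 : ℝ) < v n := by exact_mod_cast hn
    refine energyControl_of_sq_mul_eq hn0 h3 hn1 ?_
    rw [hsize, Real.sq_sqrt (by positivity)]
    field_simp
  · have hsize : effectiveSampleSize γ v = fun n : ℕ => (n : ℝ) := by
      funext n; simp [effectiveSampleSize, hγ']
    rw [hsize]
    refine ⟨tendsto_natCast_atTop_atTop, ?_⟩
    filter_upwards [eventually_gt_atTop 0] with n hn
    exact energyControl_natCast hn (v n).coe_nonneg

end Contiguity

theorem mainTheorem3 {Ω : Type*} [MeasurableSpace Ω] (μ : Measure Ω) [IsProbabilityMeasure μ]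
    (ρ : ℝ) (hρ : ρ ∈ Set.Ioo (-1 : ℝ) 0 ∪ Set.Ioo (0 : ℝ) 1)
    (B : ℝ → Ω → EuclideanSpace ℝ (Fin 2)) (hB : IsTwoSidedBivariateBrownianMotion ρ B μ)
    (ε : ℕ → Ω → EuclideanSpace ℝ (Fin 2)) (hε : IsIIDStandardNormal ε μ)
    (hBε : IndepFun (fun ω t => B t ω) (fun ω i => ε i ω) μ)
    (v : ℕ → ℝ≥0) (γ : ℝ≥0∞)
    (hγ : Tendsto (fun n : ℕ => (n : ℝ≥0∞) * (v n : ℝ≥0∞)) atTop (𝓝 γ))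
    (hv : limsup (fun n : ℕ => (v n : ℝ≥0∞)) atTop < ∞)
    (θ : ℕ → ℝ) (hθ : θ =O[atTop] convergenceRate γ v) :
    IsMutuallyContiguous (fun n => lagLaw μ B ε v n (θ n)) (fun n => lagLaw μ B ε v n 0) := by
  have hρ1 : |ρ| < 1 := by
    rw [abs_lt]
    rcases hρ with h | h <;> constructor <;> linarith [h.1, h.2]
  have hκ : 0 < 1 - |ρ| := by linarith
  obtain ⟨htop, hN⟩ := eventually_energyControl hγ hv
  obtain ⟨C, hC0, hC⟩ := hθ.exists_pos
  have hcube : ∀ᶠ n in atTop, θ n ^ 2 * effectiveSampleSize γ v n ^ 3 ≤ C ^ 2 := by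
    filter_upwards [hC.bound, hN] with n hn hNn
    have hpos : 0 < effectiveSampleSize γ v n := zero_lt_one.trans_le hNn.one_le
    set N := effectiveSampleSize γ v n with hN_def
    have hr : convergenceRate γ v n = N ^ (-(3 / 2) : ℝ) := rfl
    have hr2 : (N ^ (-(3 / 2) : ℝ)) ^ 2 * N ^ 3 = 1 := by
      rw [← Real.rpow_natCast, ← Real.rpow_natCast, ← Real.rpow_mul hpos.le,
        ← Real.rpow_add hpos]
      norm_num
    rw [hr, Real.norm_eq_abs, Real.norm_of_nonneg (by positivity)] at hn
    have h2 := pow_le_pow_left₀ (abs_nonneg _) hn 2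
    rw [sq_abs, mul_pow] at h2
    calc θ n ^ 2 * N ^ 3 ≤ C ^ 2 * (N ^ (-(3 / 2) : ℝ)) ^ 2 * N ^ 3 := by gcongr
      _ = C ^ 2 := by rw [mul_assoc, hr2, mul_one]
  -- The operator bound is implied by the cubic one: (40|θ|N)² = 1600 θ²N³/N ≤ 1600 C²/N, which
  -- tends to zero.
  have hsmall : ∀ᶠ n in atTop, 40 * |θ n| * effectiveSampleSize γ v n ≤ 1 - |ρ| := by
    filter_upwards [hcube, hN, htop.eventually_ge_atTop (1600 * C ^ 2 / (1 - |ρ|) ^ 2)]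
      with n hn hNn hbig
    have hpos : 0 < effectiveSampleSize γ v n := zero_lt_one.trans_le hNn.one_le
    set N := effectiveSampleSize γ v n
    rw [div_le_iff₀ (by positivity)] at hbig
    refine le_of_sq_le_sq ?_ hκ.le
    refine le_of_mul_le_mul_left ?_ hpos
    calc N * (40 * |θ n| * N) ^ 2 = 1600 * (θ n ^ 2 * N ^ 3) := by rw [← sq_abs (θ n)]; ring
      _ ≤ 1600 * C ^ 2 := by gcongr
      _ ≤ _ := hbig
  have key : ∀ᶠ n in atTop, ∀ A : Set (Fin n ⊕ Fin n → ℝ), MeasurableSet A →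
      lagLaw μ B ε v n (θ n) A ^ 2 ≤
          ENNReal.ofReal (Real.exp (4 * (82 * C ^ 2 / (1 - |ρ|) ^ 2))) * lagLaw μ B ε v n 0 A ∧
        lagLaw μ B ε v n 0 A ^ 2 ≤
          ENNReal.ofReal (Real.exp (4 * (82 * C ^ 2 / (1 - |ρ|) ^ 2))) *
            lagLaw μ B ε v n (θ n) A := by
    filter_upwards [hcube, hN, hsmall] with n h1 h2 h3 A hA
    obtain ⟨h4, h5⟩ := lagLaw_measure_sq_le hB hε hBε hρ1 v h2 h3 hA
    constructor
    · refine h4.trans ?_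
      gcongr
    · refine h5.trans ?_
      gcongr
  exact ⟨IsContiguous.of_measure_sq_le ENNReal.ofReal_ne_top
      (key.mono fun n hn A hA => (hn A hA).1),
    IsContiguous.of_measure_sq_le ENNReal.ofReal_ne_top
      (key.mono fun n hn A hA => (hn A hA).2)⟩
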